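/- Let $d\ge 1$ be an integer, $\mathbb{N}=\{0,1,2,\dots\}$, and $\mathbb{T}^d=\{\mathbf z\in\mathbb{C}^d: |z_1|=\dots=|z_d|=1\}$. For $\mathbf n\in\mathbb{N}^d$ put $|\mathbf n+\mathbf 1|=\prod_j (n_j+1)$; sums $\sum_{\mathbf k=\mathbf 0}^{\mathbf n}$ and $\sum_{\mathbf k=-\mathbf n}^{\mathbf n}$ run over the corresponding boxes, $\mathbf z^{\mathbf k}=\prod_j z_j^{k_j}$, and $\lim_{\mathbf n}$ means that all coordinates $n_j$ tend to infinity independently. Let $\mathbf a=\{a(\mathbf k)\}_{\mathbf k\in\mathbb{N}^d}$ be a complex sequence, extended by $0$ to $\mathbb{Z}^d$. * $\mathbf a$ is *bounded Besicovitch* if it is bounded and for every $\varepsilon>0$ there is a trigonometric polynomial $P(\mathbf k)=\sum_{\alpha}c_\alpha \mathbf z_\alpha^{\mathbf k}$ (finite sum, $c_\alpha\in\mathbb{C}$, $\mathbf z_\alpha\in\mathbb{T}^d$) such that $\lim_{\mathbf n}\frac1{|\mathbf n+\mathbf 1|}\sum_{\mathbf k=\mathbf 0}^{\mathbf n}|a(\mathbf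 k)-P(\mathbf k)|$ exists and is $<\varepsilon$. * $\mathbf a$ *has a correlation* if $\gamma_{\mathbf a}(\mathbf m)=\lim_{\mathbf n}\frac1{|\mathbf n+\mathbf 1|}\sum_{\mathbf k=-\mathbf n}^{\mathbf n}\overline{a(\mathbf k)}\,a(\mathbf k+\mathbf m)$ exists for all $\mathbf m\in\mathbb{Z}^d$. If $\mathbf a$ is bounded and has a correlation, its *spectral measure* $\sigma_{\mathbf a}$ is the unique finite positive Borel measure on $\mathbb{T}^d$ with $\gamma_{\mathbf a}(\mathbf m)=\int_{\mathbb{T}^d}\mathbf z^{\mathbf m}\,d\sigma_{\mathbf a}(\mathbf z)$ for all $\mathbf m\in\mathbb{Z}^d$. It is *discrete* if it is carried by a countable set. * The *amplitude* of $\mathbf a$ at $\mathbf z\in\mathbb{T}^d$ is $\Gamma_{\mathbf a}(\mathbf z)=\lim_{\mathbf n}\frac1{|\mathbf n+\mathbf 1|}\sum_{\mathbf k=\mathbf 0}^{\mathbf n}a(\mathbf k)\overline{\mathbf z}^{\mathbf k}$, if this limit exists. * $\mathcal D$ is the set of all bounded $\mathbf a$ that have a correlation and a discrete spectral measure and for which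 $\lim_{\mathbf n}\frac1{|\mathbf n+\mathbf 1|}\sum_{\mathbf k=\mathbf 0}^{\mathbf n}a(\mathbf k)\mathbf z^{\mathbf k}$ exists for all $\mathbf z\in\mathbb{T}^d$. **Theorem.** (i) A sequence $\mathbf a$ is bounded Besicovitch if and only if the following three conditions hold: 1. $\mathbf a$ is bounded and has a correlation, and its spectral measure $\sigma_{\mathbf a}$ is discrete; 2. the amplitude $\Gamma_{\mathbf a}(\mathbf z)$ exists for all $\mathbf z\in\mathbb{T}^d$; 3. $\sigma_{\mathbf a}(\{\mathbf z\})=|\Gamma_{\mathbf a}(\mathbf z)|^2$ for all $\mathbf z\in\mathbb{T}^d$. (ii) The sequence $a(\mathbf k)=(-1)^{\lfloor\sqrt{k_1+\dots+k_d}\rfloor}$ satisfies (1) and (2) but not (3): it has $\gamma_{\mathbf a}(\mathbf m)=1$ for all $\mathbf m\in\mathbb{Z}^d$, $\sigma_{\mathbf a}$ is the Dirac measure at $\mathbf 1=(1,\dots,1)$, and $\Gamma_{\mathbf a}(\mathbf z)=0$ for all $\mathbf z\in\mathbb{T}^d$. (iii) The class of bounded Besicovitch sequences is strictly contained in $\mathcal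 D$. -/

import Mathlib

open Filter Topology MeasureTheory
open scoped ComplexConjugate

/-- Multi-parameter weight sequences `a = {a(k)}`, `k ∈ ℕ^d`. -/
abbrev MultiSeq (d : ℕ) : Type := (Fin d → ℕ) → ℂ

/-- The torus `𝕋^d`. -/
abbrev Torus (d : ℕ) : Type := Fin d → Circle

/-- The Borel `σ`-algebra of the circle; `𝕋^d` carries the product `σ`-algebra, which is its Borel
`σ`-algebra by `Torus.borelSpace`. -/
noncomputable instance Circle.borelMeasurableSpace : MeasurableSpace Circle := borel Circle

instance Circle.borelSpace : BorelSpace Circle := ⟨rfl⟩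

instance Circle.secondCountableTopology : SecondCountableTopology Circle :=
  inferInstanceAs (SecondCountableTopology (Metric.sphere (0 : ℂ) 1))

theorem Torus.borelSpace (d : ℕ) : BorelSpace (Torus d) := inferInstance

namespace MultiSeq

variable {d : ℕ}

/-- `|n + 1| = (n_1 + 1) ⋯ (n_d + 1)`, as a real number. -/
noncomputable def boxSize (n : Fin d → ℕ) : ℝ := ∏ i, ((n i : ℝ) + 1)

/-- `z^k = z_1^{k_1} ⋯ z_d^{k_d}` for `k ∈ ℕ^d`. -/
noncomputable def natMonomial (z : Torus d) (k : Fin d → ℕ) : ℂ := ∏ i, (z i : ℂ) ^ (k i)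

/-- `z^m = z_1^{m_1} ⋯ z_d^{m_d}` for `m ∈ ℤ^d`. -/
noncomputable def intMonomial (z : Torus d) (m : Fin d → ℤ) : ℂ := ∏ i, (z i : ℂ) ^ (m i)

/-- The averages `|n + 1|⁻¹ ∑_{0 ≤ k ≤ n} b(k)`. Multi-parameter limits `lim_n` are limits along
`atTop` on `ℕ^d`, that is, all coordinates of `n` tend to infinity independently. -/
noncomputable def average (b : MultiSeq d) (n : Fin d → ℕ) : ℂ :=
  ((boxSize n : ℝ) : ℂ)⁻¹ * ∑ k ∈ Finset.Icc 0 n, b k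

/-- The space of bounded sequences. -/
def IsBoundedSeq (a : MultiSeq d) : Prop := ∃ C : ℝ, ∀ k, ‖a k‖ ≤ C

/-- Trigonometric polynomials `P(k) = ∑_α c_α z_α^k` (finite sums). -/
def IsTrigPoly (P : MultiSeq d) : Prop :=
  ∃ (N : ℕ) (c : Fin N → ℂ) (w : Fin N → Torus d),
    ∀ k, P k = ∑ j, c j * natMonomial (w j) k

/-- The Besicovitch class `B(p)`, `1 ≤ p < ∞`: for each `ε > 0` there is a trigonometric
polynomial `P` such that `lim_n |n + 1|⁻¹ ∑_{0 ≤ k ≤ n} |a(k) - P(k)|^p` exists and is `< ε`. -/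
def IsBesicovitch (p : ℝ) (a : MultiSeq d) : Prop :=
  ∀ ε : ℝ, 0 < ε → ∃ P : MultiSeq d, IsTrigPoly P ∧ ∃ L : ℝ, L < ε ∧
    Tendsto (fun n : Fin d → ℕ => (boxSize n)⁻¹ * ∑ k ∈ Finset.Icc 0 n, ‖a k - P k‖ ^ p)
      atTop (𝓝 L)

/-- Bounded Besicovitch sequences. -/
def IsBoundedBesicovitch (a : MultiSeq d) : Prop := IsBesicovitch 1 a ∧ IsBoundedSeq a

/-- The extension of `a` to `ℤ^d` by zero off `ℕ^d`. -/
noncomputable def zeroExtend (a : MultiSeq d) (k : Fin d → ℤ) : ℂ :=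
  open Classical in if ∀ i, 0 ≤ k i then a (fun i => (k i).toNat) else 0

/-- The averages `|n + 1|⁻¹ ∑_{-n ≤ k ≤ n} conj (a(k)) a(k + m)` of the zero extension. -/
noncomputable def correlationAverage (a : MultiSeq d) (m : Fin d → ℤ) (n : Fin d → ℕ) : ℂ :=
  ((boxSize n : ℝ) : ℂ)⁻¹ *
    ∑ k ∈ Finset.Icc (fun i => -(n i : ℤ)) (fun i => (n i : ℤ)),
      conj (zeroExtend a k) * zeroExtend a (k + m)

/-- `γ` is the correlation function of `a`. -/
def IsCorrelation (a : MultiSeq d) (γ : (Fin d → ℤ) → ℂ) : Prop :=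
  ∀ m, Tendsto (correlationAverage a m) atTop (𝓝 (γ m))

/-- `a` has a correlation, that is, `a` belongs to the space `S`. -/
def HasCorrelation (a : MultiSeq d) : Prop := ∃ γ : (Fin d → ℤ) → ℂ, IsCorrelation a γ

/-- `σ` is a finite positive Borel measure on `𝕋^d` with `γ_a(m) = ∫ z^m dσ(z)` for all `m`. -/
def IsSpectralMeasure (a : MultiSeq d) (σ : Measure (Torus d)) : Prop :=
  IsFiniteMeasure σ ∧ IsCorrelation a (fun m => ∫ z, intMonomial z m ∂σ)

/-- The spectral measure `σ_a` of a sequence `a` that has a correlation: the measure which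
represents the correlation of `a`. It is unique, and for bounded `a` it exists by Bochner's theorem
on `ℤ^d`. (Where no such
measure exists, the value `0` is a convention.) -/
noncomputable def spectralMeasure (a : MultiSeq d) : Measure (Torus d) :=
  open Classical in if h : ∃ σ, IsSpectralMeasure a σ then h.choose else 0

/-- A measure is discrete if it is carried by a countable set. -/
def IsDiscreteMeasure (σ : Measure (Torus d)) : Prop :=
  ∃ s : Set (Torus d), s.Countable ∧ σ sᶜ = 0

/-- The averages `|n + 1|⁻¹ ∑_{0 ≤ k ≤ n} a(k) conj (z)^k`. -/
noncomputable def amplitudeAverage (a : MultiSeq d) (z : Torus d) : (Fin d → ℕ) → ℂ :=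
  average (fun k => a k * conj (natMonomial z k))

/-- The amplitude `Γ_a(z)` exists. -/
def HasAmplitudeAt (a : MultiSeq d) (z : Torus d) : Prop :=
  ∃ L : ℂ, Tendsto (amplitudeAverage a z) atTop (𝓝 L)

/-- The amplitude `Γ_a(z)`, meaningful where `HasAmplitudeAt a z`. -/
noncomputable def amplitude (a : MultiSeq d) (z : Torus d) : ℂ :=
  limUnder atTop (amplitudeAverage a z)

/-- Condition (1): `a` is bounded, has a correlation, and its spectral measure is discrete. -/
def BoundedDiscreteSpectrum (a : MultiSeq d) : Prop :=
  HasCorrelation a ∧ IsBoundedSeq a ∧ IsDiscreteMeasure (spectralMeasure a)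

/-- Condition (2): the amplitude exists at every point of `𝕋^d`. -/
def HasAmplitude (a : MultiSeq d) : Prop := ∀ z : Torus d, HasAmplitudeAt a z

/-- Condition (3): `σ_a({z}) = |Γ_a(z)|²` for all `z`. -/
def AtomsEqAmplitudeSq (a : MultiSeq d) : Prop :=
  ∀ z : Torus d, (spectralMeasure a).real {z} = ‖amplitude a z‖ ^ 2

/-- The class `𝒟`: bounded sequences with a correlation and a discrete spectral measure, such
that `lim_n |n + 1|⁻¹ ∑_{0 ≤ k ≤ n} a(k) z^k` exists for all `z ∈ 𝕋^d`. -/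
def classD (d : ℕ) : Set (MultiSeq d) :=
  {a | HasCorrelation a ∧ IsBoundedSeq a ∧ IsDiscreteMeasure (spectralMeasure a) ∧
    ∀ z : Torus d, ∃ L : ℂ, Tendsto (average (fun k => a k * natMonomial z k)) atTop (𝓝 L)}

/-- The sequence `a(k) = (-1)^⌊√(k_1 + ⋯ + k_d)⌋`. -/
def sqrtSignSeq (d : ℕ) : MultiSeq d := fun k => (-1) ^ Nat.sqrt (∑ i, k i)

end MultiSeq

namespace MultiSeq

variable {d : ℕ}

/-! ### Averages and means -/

/-! Measure closeness of sequences by eventual upper bounds on the averages of `‖a - P‖`. Means then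
pass from approximants to limits (`exists_hasMean_of_approx`, `HasMean.norm_sub_le`), and characters
are orthonormal for the mean (`hasMean_natMonomial`). The Besicovitch condition reduces to
`MeanApprox`: the limit demanded by the definition exists automatically, because continuous
functions of trigonometric polynomials have means.

For a bounded sequence approximable in mean, amplitudes and correlations are limits of those
computed with an approximant `P`. Replacing the unshifted factor of the correlation by `P = ∑ c_w
w^k` turns `γ(m)` into `∑ conj c_w w^m Γ(w)`, with an error uniform in `m`. Wiener's formula for
atoms then gives `σ{z} ≈ conj c_z Γ(z) ≈ |Γ(z)|²` (`MeanApprox.atoms`).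

The other main tool is the Pythagorean identity `tendsto_realAverage_sq_sub`: the quadratic mean
error of `∑_{w ∈ s} c_w w^k` is `σ(𝕋^d) - ∑ |Γ(w)|² + ∑ |Γ(w) - c_w|²`. When the atoms are the
`|Γ|²`, the first two terms are the mass of `σ` off `s`. Hence good quadratic approximation forces
discreteness. Conversely, if `σ` is discrete, the coefficients `c = Γ` on a large finite set give a
good approximation, and Cauchy–Schwarz returns to the first-power mean.

In the example the sign is constant on longer and longer blocks. A fixed shift therefore alters it
on a set of density zero, so `γ = 1` and `σ` is the Dirac mass at `1`. Yet successive blocks cancel,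
so the mean is zero; against a nontrivial character, summation by parts gives zero as well. The atom
at `1` has mass one and amplitude zero, which also separates the two classes in the last claim. -/

/-- `b` has the mean `L`: the averages of `b` over the boxes `[0, n]` converge to `L`. -/
def HasMean (b : MultiSeq d) (L : ℂ) : Prop := Tendsto (average b) atTop (𝓝 L)

/-- Averages of real sequences. -/
noncomputable def realAverage (f : (Fin d → ℕ) → ℝ) (n : Fin d → ℕ) : ℝ :=
  (boxSize n)⁻¹ * ∑ k ∈ Finset.Icc 0 n, f k

theorem boxSize_pos (n : Fin d → ℕ) : 0 < boxSize n :=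
  Finset.prod_pos fun i _ => by positivity

theorem card_Icc_zero (n : Fin d → ℕ) : ((Finset.Icc 0 n).card : ℝ) = boxSize n := by
  rw [Pi.card_Icc]
  simp [boxSize]

theorem average_add (b c : MultiSeq d) (n : Fin d → ℕ) :
    average (fun k => b k + c k) n = average b n + average c n := by
  simp [average, Finset.sum_add_distrib, mul_add]

theorem average_sub (b c : MultiSeq d) (n : Fin d → ℕ) :
    average (fun k => b k - c k) n = average b n - average c n := by
  simp [average, Finset.sum_sub_distrib, mul_sub]

theorem average_const_mul (c : ℂ) (b : MultiSeq d) (n : Fin d → ℕ) :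
    average (fun k => c * b k) n = c * average b n := by
  simp only [average, ← Finset.mul_sum]
  ring

theorem average_sum {ι : Type*} (s : Finset ι) (b : ι → MultiSeq d) (n : Fin d → ℕ) :
    average (fun k => ∑ i ∈ s, b i k) n = ∑ i ∈ s, average (b i) n := by
  simp only [average, ← Finset.mul_sum]
  rw [Finset.sum_comm]

theorem average_conj (b : MultiSeq d) (n : Fin d → ℕ) :
    average (fun k => conj (b k)) n = conj (average b n) := by
  simp [average]

theorem average_ofReal (f : (Fin d → ℕ) → ℝ) (n : Fin d → ℕ) :
    average (fun k => (f k : ℂ)) n = (realAverage f n : ℝ) := by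
  simp [average, realAverage]

theorem realAverage_mono {f g : (Fin d → ℕ) → ℝ} {n : Fin d → ℕ} (h : ∀ k ≤ n, f k ≤ g k) :
    realAverage f n ≤ realAverage g n := by
  refine mul_le_mul_of_nonneg_left (Finset.sum_le_sum fun k hk => ?_)
    (inv_nonneg.2 (boxSize_pos n).le)
  exact h k (Finset.mem_Icc.1 hk).2

theorem realAverage_add (f g : (Fin d → ℕ) → ℝ) (n : Fin d → ℕ) :
    realAverage (fun k => f k + g k) n = realAverage f n + realAverage g n := by
  simp [realAverage, Finset.sum_add_distrib, mul_add]

theorem realAverage_const_mul (c : ℝ) (f : (Fin d → ℕ) → ℝ) (n : Fin d → ℕ) :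
    realAverage (fun k => c * f k) n = c * realAverage f n := by
  simp only [realAverage, ← Finset.mul_sum]
  ring

theorem realAverage_const (c : ℝ) (n : Fin d → ℕ) : realAverage (fun _ => c) n = c := by
  rw [realAverage, Finset.sum_const, nsmul_eq_mul, card_Icc_zero,
    inv_mul_cancel_left₀ (boxSize_pos n).ne']

theorem realAverage_nonneg {f : (Fin d → ℕ) → ℝ} (h : ∀ k, 0 ≤ f k) (n : Fin d → ℕ) :
    0 ≤ realAverage f n :=
  mul_nonneg (inv_nonneg.2 (boxSize_pos n).le) (Finset.sum_nonneg fun k _ => h k)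

theorem norm_average_le (b : MultiSeq d) (n : Fin d → ℕ) :
    ‖average b n‖ ≤ realAverage (fun k => ‖b k‖) n := by
  rw [average, realAverage, norm_mul, norm_inv, Complex.norm_real,
    Real.norm_of_nonneg (boxSize_pos n).le]
  exact mul_le_mul_of_nonneg_left (norm_sum_le _ _) (inv_nonneg.2 (boxSize_pos n).le)

theorem norm_average_le_of_bound {b : MultiSeq d} {C : ℝ} (hb : ∀ k, ‖b k‖ ≤ C) (n : Fin d → ℕ) :
    ‖average b n‖ ≤ C :=
  (norm_average_le b n).trans <|
    (realAverage_mono fun k _ => hb k).trans_eq (realAverage_const C n)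

/-- Cauchy–Schwarz; this is the passage from quadratic mean to first-power mean in the converse
direction. -/
theorem sq_realAverage_le (f : (Fin d → ℕ) → ℝ) (n : Fin d → ℕ) :
    realAverage f n ^ 2 ≤ realAverage (fun k => f k ^ 2) n := by
  have hpos := boxSize_pos n
  have h := sq_sum_le_card_mul_sum_sq (s := Finset.Icc 0 n) (f := f)
  rw [card_Icc_zero] at h
  rw [realAverage, realAverage, mul_pow, inv_pow, ← div_eq_inv_mul, ← div_eq_inv_mul,
    div_le_div_iff₀ (by positivity) hpos]
  calc _ ≤ (boxSize n * ∑ k ∈ Finset.Icc 0 n, f k ^ 2) * boxSize n := by gcongr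
    _ = _ := by ring

namespace HasMean

variable {b c : MultiSeq d} {L M : ℂ}

theorem add (h : HasMean b L) (h' : HasMean c M) : HasMean (fun k => b k + c k) (L + M) :=
  (Tendsto.add h h').congr fun n => (average_add b c n).symm

theorem sub (h : HasMean b L) (h' : HasMean c M) : HasMean (fun k => b k - c k) (L - M) :=
  (Tendsto.sub h h').congr fun n => (average_sub b c n).symm

theorem const_mul (h : HasMean b L) (r : ℂ) : HasMean (fun k => r * b k) (r * L) :=
  (Tendsto.const_mul r h).congr fun n => (average_const_mul r b n).symm

theorem star (h : HasMean b L) : HasMean (fun k => conj (b k)) (conj L) :=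
  ((Complex.continuous_conj.tendsto L).comp h).congr fun n => (average_conj b n).symm

theorem sum {ι : Type*} {s : Finset ι} {b : ι → MultiSeq d} {L : ι → ℂ}
    (h : ∀ i ∈ s, HasMean (b i) (L i)) :
    HasMean (fun k => ∑ i ∈ s, b i k) (∑ i ∈ s, L i) :=
  (tendsto_finsetSum s h).congr fun n => (average_sum s b n).symm

theorem norm_sub_le {ε : ℝ} (h : HasMean b L) (h' : HasMean c M)
    (hε : ∀ᶠ n in atTop, realAverage (fun k => ‖b k - c k‖) n ≤ ε) : ‖L - M‖ ≤ ε :=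
  le_of_tendsto (h.sub h').norm (hε.mono fun n hn => (norm_average_le _ n).trans hn)

theorem norm_le {C : ℝ} (h : HasMean b L) (hb : ∀ k, ‖b k‖ ≤ C) : ‖L‖ ≤ C :=
  le_of_tendsto h.norm (Eventually.of_forall fun n => norm_average_le_of_bound hb n)

end HasMean

theorem hasMean_ofReal_iff {f : (Fin d → ℕ) → ℝ} {L : ℝ} :
    HasMean (fun k => (f k : ℂ)) L ↔ Tendsto (realAverage f) atTop (𝓝 L) := by
  rw [HasMean, funext (average_ofReal f)]
  exact tendsto_ofReal_iff

/-- A sequence which is approximable in mean by sequences that have a mean has a mean. -/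
theorem exists_hasMean_of_approx {b : MultiSeq d}
    (h : ∀ ε : ℝ, 0 < ε → ∃ c : MultiSeq d, (∃ L, HasMean c L) ∧
      ∀ᶠ n in atTop, realAverage (fun k => ‖b k - c k‖) n ≤ ε) : ∃ L, HasMean b L := by
  refine cauchySeq_tendsto_of_complete (Metric.cauchySeq_iff'.2 fun ε hε => ?_)
  obtain ⟨c, ⟨L, hL⟩, hc⟩ := h (ε / 8) (by positivity)
  obtain ⟨N, hN⟩ := eventually_atTop.1 (hc.and (Metric.tendsto_nhds.1 hL (ε / 8) (by positivity)))
  have key : ∀ n ≥ N, dist (average b n) L < ε / 2 := fun n hn => by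
    obtain ⟨h1, h2⟩ := hN n hn
    have h3 := (norm_average_le _ n).trans h1
    rw [average_sub, ← dist_eq_norm] at h3
    linarith [dist_triangle (average b n) (average c n) L]
  exact ⟨N, fun n hn => by
    linarith [dist_triangle_right (average b n) (average b N) L, key n hn, key N le_rfl]⟩

/-! ### Monomials -/

theorem natMonomial_mul (z w : Torus d) (k : Fin d → ℕ) :
    natMonomial (z * w) k = natMonomial z k * natMonomial w k := by
  simp [natMonomial, mul_pow, Finset.prod_mul_distrib]

theorem natMonomial_one (k : Fin d → ℕ) : natMonomial (1 : Torus d) k = 1 := by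
  simp [natMonomial]

theorem natMonomial_inv (z : Torus d) (k : Fin d → ℕ) :
    natMonomial z⁻¹ k = conj (natMonomial z k) := by
  simp only [natMonomial, Pi.inv_apply, Circle.coe_inv_eq_conj, map_prod, map_pow]

theorem norm_natMonomial (z : Torus d) (k : Fin d → ℕ) : ‖natMonomial z k‖ = 1 := by
  simp [natMonomial, Circle.norm_coe]

theorem intMonomial_natCast (z : Torus d) (k : Fin d → ℕ) :
    intMonomial z (fun i => (k i : ℤ)) = natMonomial z k := by
  simp [intMonomial, natMonomial]

theorem norm_intMonomial (z : Torus d) (m : Fin d → ℤ) : ‖intMonomial z m‖ = 1 := by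
  simp [intMonomial, Circle.norm_coe]

theorem intMonomial_add (z : Torus d) (m n : Fin d → ℤ) :
    intMonomial z (m + n) = intMonomial z m * intMonomial z n := by
  simp [intMonomial, zpow_add₀, Finset.prod_mul_distrib]

theorem intMonomial_zero (z : Torus d) : intMonomial z 0 = 1 := by
  simp [intMonomial]

theorem intMonomial_one (m : Fin d → ℤ) : intMonomial (1 : Torus d) m = 1 := by
  simp [intMonomial]

theorem intMonomial_mul (z w : Torus d) (m : Fin d → ℤ) :
    intMonomial (z * w) m = intMonomial z m * intMonomial w m := by
  simp [intMonomial, mul_zpow, Finset.prod_mul_distrib]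

theorem intMonomial_neg (z : Torus d) (m : Fin d → ℤ) :
    intMonomial z (-m) = conj (intMonomial z m) := by
  simp only [intMonomial, map_prod, map_zpow₀, ← Circle.coe_inv_eq_conj, Circle.coe_inv,
    Pi.neg_apply, inv_zpow']

theorem continuous_coe_circle : Continuous fun z : Circle => (z : ℂ) := continuous_subtype_val

theorem continuous_intMonomial (m : Fin d → ℤ) : Continuous fun z : Torus d => intMonomial z m := by
  refine continuous_finsetProd _ fun i _ => ?_
  exact (continuous_coe_circle.comp (continuous_apply i)).zpow₀ (m i) fun z => Or.inl (by simp)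

/-- Makes the average of a monomial a product of one-variable geometric averages. -/
theorem sum_Icc_prod {R : Type*} [CommSemiring R] (f : Fin d → ℕ → R) (n : Fin d → ℕ) :
    ∑ k ∈ Finset.Icc 0 n, ∏ i, f i (k i) = ∏ i, ∑ k ∈ Finset.range (n i + 1), f i k := by
  rw [Finset.prod_univ_sum]
  refine Finset.sum_congr ?_ fun _ _ => rfl
  ext k
  simp [Pi.le_def]

theorem average_natMonomial (z : Torus d) (n : Fin d → ℕ) :
    average (natMonomial z) n =
      ∏ i, ((n i : ℂ) + 1)⁻¹ * ∑ k ∈ Finset.range (n i + 1), (z i : ℂ) ^ k := by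
  rw [average, Finset.prod_mul_distrib, ← sum_Icc_prod]
  simp [boxSize, natMonomial]

/-- The geometric sums stay bounded by `2 / ‖w - 1‖`, so dividing by `n + 1` kills them. -/
theorem tendsto_geom_average_zero {w : Circle} (hw : w ≠ 1) :
    Tendsto (fun n : ℕ => ((n : ℂ) + 1)⁻¹ * ∑ k ∈ Finset.range (n + 1), (w : ℂ) ^ k)
      atTop (𝓝 0) := by
  have hw' : (w : ℂ) ≠ 1 := fun h => hw (Circle.coe_eq_one.1 h)
  have h0 : Tendsto (fun n : ℕ => (2 / ‖(w : ℂ) - 1‖) * (1 / ((n : ℝ) + 1))) atTop (𝓝 0) := by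
    simpa using (tendsto_one_div_add_atTop_nhds_zero_nat (𝕜 := ℝ)).const_mul (2 / ‖(w : ℂ) - 1‖)
  refine squeeze_zero_norm (fun n => ?_) h0
  have h2 : ‖(w : ℂ) ^ (n + 1) - 1‖ ≤ 2 := (norm_sub_le _ _).trans (by norm_num [Circle.norm_coe])
  have h3 : ‖((n : ℂ) + 1)⁻¹‖ = 1 / ((n : ℝ) + 1) := by
    rw [norm_inv, ← Nat.cast_succ, Complex.norm_natCast]
    simp
  rw [geom_sum_eq hw', norm_mul, norm_div, h3, mul_comm]
  gcongr

theorem norm_geom_average_le (w : Circle) (n : ℕ) :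
    ‖((n : ℂ) + 1)⁻¹ * ∑ k ∈ Finset.range (n + 1), (w : ℂ) ^ k‖ ≤ 1 := by
  have h3 : ‖((n : ℂ) + 1)⁻¹‖ = ((n : ℝ) + 1)⁻¹ := by
    rw [norm_inv, ← Nat.cast_succ, Complex.norm_natCast]
    simp
  rw [norm_mul, h3, inv_mul_le_iff₀ (by positivity)]
  exact (norm_sum_le _ _).trans (by simp [Circle.norm_coe])

theorem tendsto_eval_atTop (i : Fin d) :
    Tendsto (fun n : Fin d → ℕ => n i) atTop atTop :=
  tendsto_atTop.2 fun N => by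
    filter_upwards [eventually_ge_atTop fun _ => N] with n hn using hn i

-- Orthogonality of characters. One coordinate with `z i ≠ 1` suffices: its factor tends to zero and
-- all the others are at most one.
open Classical in
theorem hasMean_natMonomial (z : Torus d) :
    HasMean (natMonomial z) (if z = 1 then 1 else 0) := by
  split_ifs with hz
  · subst hz
    refine tendsto_const_nhds.congr fun n => ?_
    rw [average_natMonomial]
    refine (Finset.prod_eq_one fun i _ => ?_).symm
    have : (n i : ℂ) + 1 ≠ 0 := by exact_mod_cast Nat.succ_ne_zero (n i)
    simp [this]
  · obtain ⟨i, hi⟩ := Function.ne_iff.1 hz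
    refine squeeze_zero_norm (fun n => ?_)
      ((tendsto_zero_iff_norm_tendsto_zero.1 (tendsto_geom_average_zero hi)).comp
        (tendsto_eval_atTop i))
    rw [average_natMonomial, ← Finset.mul_prod_erase _ _ (Finset.mem_univ i), norm_mul, norm_prod]
    exact mul_le_of_le_one_right (norm_nonneg _) <| Finset.prod_le_one (fun _ _ => norm_nonneg _)
      fun j _ => norm_geom_average_le _ _

/-! ### Trigonometric polynomials -/

theorem isTrigPoly_of_fintype {ι : Type*} [Fintype ι] {P : MultiSeq d} (c : ι → ℂ)
    (w : ι → Torus d) (h : ∀ k, P k = ∑ i, c i * natMonomial (w i) k) : IsTrigPoly P := by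
  let e := Fintype.equivFin ι
  refine ⟨Fintype.card ι, c ∘ e.symm, w ∘ e.symm, fun k => ?_⟩
  rw [h k]
  exact (e.symm.sum_comp fun i => c i * natMonomial (w i) k).symm

/-- A trigonometric polynomial written with distinct frequencies. -/
theorem IsTrigPoly.exists_finsupp {P : MultiSeq d} (h : IsTrigPoly P) :
    ∃ c : Torus d →₀ ℂ, ∀ k, P k = ∑ w ∈ c.support, c w * natMonomial w k := by
  obtain ⟨N, c, w, h⟩ := h
  refine ⟨∑ j, Finsupp.single (w j) (c j), fun k => ?_⟩
  change P k = (∑ j, Finsupp.single (w j) (c j)).sum fun w a => a * natMonomial w k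
  rw [h k, ← Finsupp.sum_finsetSum_index (by simp) (by simp [add_mul])]
  simp

theorem isTrigPoly_sum (s : Finset (Torus d)) (c : Torus d → ℂ) :
    IsTrigPoly fun k => ∑ w ∈ s, c w * natMonomial w k :=
  isTrigPoly_of_fintype (fun w : s => c w) (fun w : s => (w : Torus d)) fun k =>
    (Finset.sum_coe_sort s fun w => c w * natMonomial w k).symm

theorem isTrigPoly_const (r : ℂ) : IsTrigPoly fun _ : Fin d → ℕ => r :=
  isTrigPoly_of_fintype (fun _ : Unit => r) (fun _ => 1) fun k => by simp [natMonomial_one]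

namespace IsTrigPoly

variable {P Q : MultiSeq d}

theorem add (hP : IsTrigPoly P) (hQ : IsTrigPoly Q) : IsTrigPoly fun k => P k + Q k := by
  obtain ⟨N, c, w, h⟩ := hP
  obtain ⟨M, c', w', h'⟩ := hQ
  refine isTrigPoly_of_fintype (Sum.elim c c') (Sum.elim w w') fun k => ?_
  simp [Fintype.sum_sum_type, h, h']

theorem mul (hP : IsTrigPoly P) (hQ : IsTrigPoly Q) : IsTrigPoly fun k => P k * Q k := by
  obtain ⟨N, c, w, h⟩ := hP
  obtain ⟨M, c', w', h'⟩ := hQ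
  refine isTrigPoly_of_fintype (fun p : Fin N × Fin M => c p.1 * c' p.2)
    (fun p => w p.1 * w' p.2) fun k => ?_
  rw [h, h', Finset.sum_mul_sum, Fintype.sum_prod_type]
  refine Finset.sum_congr rfl fun i _ => Finset.sum_congr rfl fun j _ => ?_
  rw [natMonomial_mul]
  ring

theorem star (hP : IsTrigPoly P) : IsTrigPoly fun k => conj (P k) := by
  obtain ⟨N, c, w, h⟩ := hP
  refine isTrigPoly_of_fintype (fun i => conj (c i)) (fun i => (w i)⁻¹) fun k => ?_
  simp [h, natMonomial_inv]

theorem sub (hP : IsTrigPoly P) (hQ : IsTrigPoly Q) : IsTrigPoly fun k => P k - Q k := by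
  simpa [sub_eq_add_neg] using hP.add ((isTrigPoly_const (-1)).mul hQ)

theorem exists_bound (hP : IsTrigPoly P) : IsBoundedSeq P := by
  obtain ⟨N, c, w, h⟩ := hP
  refine ⟨∑ j, ‖c j‖, fun k => ?_⟩
  rw [h k]
  exact (norm_sum_le _ _).trans (by simp [norm_natMonomial])

theorem exists_hasMean (hP : IsTrigPoly P) : ∃ L, HasMean P L := by
  classical
  obtain ⟨N, c, w, h⟩ := hP
  rw [funext h]
  exact ⟨_, HasMean.sum fun j _ => (hasMean_natMonomial (w j)).const_mul (c j)⟩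

/-- Continuous functions of trigonometric polynomials are uniform limits of trigonometric
polynomials. -/
theorem exists_near_comp (hP : IsTrigPoly P) {G : ℂ → ℂ} (hG : Continuous G) {ε : ℝ}
    (hε : 0 < ε) : ∃ Q, IsTrigPoly Q ∧ ∀ k, ‖G (P k) - Q k‖ ≤ ε := by
  obtain ⟨C, hC⟩ := hP.exists_bound
  -- `P` has values in a compact disc, so Stone–Weierstrass there reduces `G` to polynomials in the
  -- variable and its conjugate.
  let s : Set ℂ := Metric.closedBall 0 C
  have : CompactSpace s := isCompact_iff_compactSpace.1 (isCompact_closedBall 0 C)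
  let x : (Fin d → ℕ) → s := fun k => ⟨P k, by simpa [s] using hC k⟩
  suffices H : ∀ f : C(s, ℂ), ∀ ε : ℝ, 0 < ε → ∃ Q, IsTrigPoly Q ∧ ∀ k, ‖f (x k) - Q k‖ ≤ ε from
    H ⟨fun y => G y, hG.comp continuous_subtype_val⟩ ε hε
  intro f
  induction f using ContinuousMap.induction_on_of_compact with
  | const r => exact fun ε hε => ⟨_, isTrigPoly_const r, fun k => by simpa using hε.le⟩
  | id => exact fun ε hε => ⟨_, hP, fun k => by simpa [x] using hε.le⟩
  | star_id => exact fun ε hε => ⟨_, hP.star, fun k => by simpa [x] using hε.le⟩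
  | add f g hf hg =>
    intro ε hε
    obtain ⟨Q, hQ, h1⟩ := hf (ε / 2) (by positivity)
    obtain ⟨R, hR, h2⟩ := hg (ε / 2) (by positivity)
    refine ⟨_, hQ.add hR, fun k => ?_⟩
    calc ‖(f + g) (x k) - (Q k + R k)‖ = ‖(f (x k) - Q k) + (g (x k) - R k)‖ := by
          rw [ContinuousMap.add_apply]; ring_nf
      _ ≤ ε / 2 + ε / 2 := norm_add_le_of_le (h1 k) (h2 k)
      _ = ε := by ring
  | mul f g hf hg =>
    intro ε hε
    -- The factor `g` is approximated first, since the tolerance for `f` depends on the bound `B` of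
    -- its approximant `R`.
    obtain ⟨R, hR, h2⟩ := hg (ε / 2 / (‖f‖ + 1)) (by positivity)
    obtain ⟨B, hB⟩ := hR.exists_bound
    obtain ⟨Q, hQ, h1⟩ := hf (ε / 2 / (|B| + 1)) (by positivity)
    refine ⟨_, hQ.mul hR, fun k => ?_⟩
    calc ‖(f * g) (x k) - Q k * R k‖
        = ‖f (x k) * (g (x k) - R k) + (f (x k) - Q k) * R k‖ := by
          rw [ContinuousMap.mul_apply]; ring_nf
      _ ≤ ‖f (x k)‖ * ‖g (x k) - R k‖ + ‖f (x k) - Q k‖ * ‖R k‖ :=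
          (norm_add_le _ _).trans_eq (by simp)
      _ ≤ (‖f‖ + 1) * (ε / 2 / (‖f‖ + 1)) + ε / 2 / (|B| + 1) * (|B| + 1) := by
          gcongr
          · exact (f.norm_coe_le_norm _).trans (by linarith)
          · exact h2 k
          · exact h1 k
          · exact (hB k).trans (by linarith [le_abs_self B])
      _ = ε := by field_simp; ring
  | frequently f hf =>
    intro ε hε
    obtain ⟨g, hg, hfg⟩ := (hf.and_eventually
      (Metric.ball_mem_nhds f (show 0 < ε / 2 by positivity))).exists
    obtain ⟨Q, hQ, h1⟩ := hg (ε / 2) (by positivity)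
    refine ⟨Q, hQ, fun k => ?_⟩
    have h2 : ‖f (x k) - g (x k)‖ ≤ ε / 2 := by
      rw [← dist_eq_norm, dist_comm]
      exact (ContinuousMap.dist_apply_le_dist _).trans (Metric.mem_ball.1 hfg).le
    calc ‖f (x k) - Q k‖ = ‖(f (x k) - g (x k)) + (g (x k) - Q k)‖ := by ring_nf
      _ ≤ ε / 2 + ε / 2 := norm_add_le_of_le h2 (h1 k)
      _ = ε := by ring

theorem exists_hasMean_comp (hP : IsTrigPoly P) {G : ℂ → ℂ} (hG : Continuous G) :
    ∃ L, HasMean (fun k => G (P k)) L :=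
  exists_hasMean_of_approx fun ε hε => by
    obtain ⟨Q, hQ, h⟩ := hP.exists_near_comp hG hε
    exact ⟨Q, hQ.exists_hasMean, Eventually.of_forall fun n =>
      (realAverage_mono fun k _ => h k).trans_eq (realAverage_const ε n)⟩

end IsTrigPoly

/-! ### Approximation in mean by trigonometric polynomials -/

/-- `a` is approximable in mean by trigonometric polynomials. -/
def MeanApprox (a : MultiSeq d) : Prop :=
  ∀ ε : ℝ, 0 < ε → ∃ P : MultiSeq d, IsTrigPoly P ∧
    ∀ᶠ n in atTop, realAverage (fun k => ‖a k - P k‖) n ≤ ε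

theorem IsBesicovitch.meanApprox {a : MultiSeq d} (h : IsBesicovitch 1 a) : MeanApprox a := by
  intro ε hε
  obtain ⟨P, hP, L, hL, hlim⟩ := h ε hε
  refine ⟨P, hP, ?_⟩
  simp only [Real.rpow_one] at hlim
  exact (hlim.eventually_lt_const hL).mono fun n hn => hn.le

/-- If `a` is approximable in mean by trigonometric polynomials, then `|a - P|` has a mean for
every trigonometric polynomial `P`. -/
theorem MeanApprox.exists_tendsto_realAverage {a P : MultiSeq d} (h : MeanApprox a)
    (hP : IsTrigPoly P) :
    ∃ L : ℝ, Tendsto (realAverage fun k => ‖a k - P k‖) atTop (𝓝 L) := by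
  obtain ⟨L, hL⟩ : ∃ L, HasMean (fun k => ((‖a k - P k‖ : ℝ) : ℂ)) L := by
    refine exists_hasMean_of_approx fun ε hε => ?_
    obtain ⟨Q, hQ, hQa⟩ := h ε hε
    refine ⟨fun k => ((‖Q k - P k‖ : ℝ) : ℂ), (hQ.sub hP).exists_hasMean_comp
      (G := fun x => ((‖x‖ : ℝ) : ℂ)) (by fun_prop), hQa.mono fun n hn => le_trans ?_ hn⟩
    refine realAverage_mono fun k _ => ?_
    rw [← Complex.ofReal_sub, Complex.norm_real]
    exact (abs_norm_sub_norm_le _ _).trans_eq (by ring_nf)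
  have hre := (Complex.continuous_re.tendsto L).comp hL
  refine ⟨L.re, hre.congr fun n => ?_⟩
  simp [average_ofReal]

/-- Existence of the limit comes for free from mean approximability, so an eventual upper bound is
all that has to be supplied. -/
theorem MeanApprox.isBesicovitch {a : MultiSeq d} (h : MeanApprox a) : IsBesicovitch 1 a := by
  intro ε hε
  obtain ⟨P, hP, hPa⟩ := h (ε / 2) (by positivity)
  obtain ⟨L, hL⟩ := h.exists_tendsto_realAverage hP
  refine ⟨P, hP, L, (le_of_tendsto hL hPa).trans_lt (by linarith), ?_⟩
  simp only [Real.rpow_one]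
  exact hL

/-- A bounded sequence which is approximable in mean is approximable in quadratic mean. -/
theorem MeanApprox.exists_sq {a : MultiSeq d} (h : MeanApprox a) (ha : IsBoundedSeq a) {ε : ℝ}
    (hε : 0 < ε) : ∃ P : MultiSeq d, IsTrigPoly P ∧
      ∀ᶠ n in atTop, realAverage (fun k => ‖a k - P k‖ ^ 2) n ≤ ε := by
  obtain ⟨C₀, hC₀⟩ := ha
  obtain ⟨C, hC, hCpos⟩ : ∃ C : ℝ, (∀ k, ‖a k‖ ≤ C) ∧ 0 < C :=
    ⟨|C₀| + 1, fun k => (hC₀ k).trans (by linarith [le_abs_self C₀]), by positivity⟩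
  -- Radial retraction onto the disc of radius `C`. Clipping `P` makes `‖a - G ∘ P‖` bounded, so its
  -- square is controlled by its first power; `G ∘ P` is then uniformly close to a trigonometric
  -- polynomial.
  let G : ℂ → ℂ := fun x => ((C / max C ‖x‖ : ℝ) : ℂ) * x
  have hmax : ∀ x : ℂ, 0 < max C ‖x‖ := fun x => lt_max_of_lt_left hCpos
  have hG : Continuous G := by
    refine (Complex.continuous_ofReal.comp ?_).mul continuous_id
    exact continuous_const.div (by fun_prop) fun x => (hmax x).ne'
  have hGle : ∀ x, ‖G x‖ ≤ C := fun x => by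
    simp only [G, norm_mul, Complex.norm_real]
    rw [Real.norm_of_nonneg (by have := hmax x; positivity), div_mul_eq_mul_div,
      div_le_iff₀ (hmax x)]
    exact mul_le_mul_of_nonneg_left (le_max_right _ _) hCpos.le
  -- `‖x - G x‖` is the distance from `x` to the disc, hence at most `‖y - x‖` for any `y` in the
  -- disc.
  have hGsub : ∀ x y : ℂ, ‖y‖ ≤ C → ‖y - G x‖ ≤ 2 * ‖y - x‖ := fun x y hy => by
    have h1 : ‖x - G x‖ ≤ ‖y - x‖ := by
      have : x - G x = ((1 - C / max C ‖x‖ : ℝ) : ℂ) * x := by simp only [G]; push_cast; ring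
      rw [this, norm_mul, Complex.norm_real, Real.norm_of_nonneg
        (sub_nonneg.2 ((div_le_one (hmax x)).2 (le_max_left _ _)))]
      rcases le_total ‖x‖ C with hx | hx
      · rw [max_eq_left hx, div_self hCpos.ne']
        simp
      · rw [max_eq_right hx, sub_mul, one_mul, div_mul_cancel₀ _ (by linarith)]
        linarith [norm_sub_norm_le x y, norm_sub_rev x y]
    calc ‖y - G x‖ = ‖(y - x) + (x - G x)‖ := by ring_nf
      _ ≤ ‖y - x‖ + ‖y - x‖ := norm_add_le_of_le le_rfl h1
      _ = 2 * ‖y - x‖ := by ring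
  -- From `(u + v)² ≤ 2u² + 2v²` the squared error is at most `8C‖a - P‖ + ε/2`; these tolerances
  -- make each term average to at most `ε/2`.
  obtain ⟨P, hP, hPa⟩ := h (ε / (16 * C)) (by positivity)
  obtain ⟨Q, hQ, hPQ⟩ := hP.exists_near_comp hG (show 0 < √(ε / 4) by positivity)
  refine ⟨Q, hQ, hPa.mono fun n hn => ?_⟩
  have hk : ∀ k, ‖a k - Q k‖ ^ 2 ≤ 8 * C * ‖a k - P k‖ + ε / 2 := fun k => by
    have h1 : ‖a k - Q k‖ ≤ ‖a k - G (P k)‖ + ‖G (P k) - Q k‖ := norm_sub_le_norm_sub_add_norm_sub ..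
    have h2 : ‖a k - G (P k)‖ ≤ 2 * C :=
      (_root_.norm_sub_le _ _).trans (by linarith [hC k, hGle (P k)])
    have h3 := hGsub (P k) (a k) (hC k)
    have h4 : ‖G (P k) - Q k‖ ^ 2 ≤ ε / 4 :=
      (pow_le_pow_left₀ (norm_nonneg _) (hPQ k) 2).trans_eq (Real.sq_sqrt (by positivity))
    have h5 : ‖a k - G (P k)‖ ^ 2 ≤ 2 * C * (2 * ‖a k - P k‖) := by
      rw [sq]
      exact mul_le_mul h2 h3 (norm_nonneg _) (by positivity)
    nlinarith [norm_nonneg (a k - Q k), sq_nonneg (‖a k - G (P k)‖ - ‖G (P k) - Q k‖)]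
  calc realAverage (fun k => ‖a k - Q k‖ ^ 2) n
      ≤ 8 * C * realAverage (fun k => ‖a k - P k‖) n + ε / 2 := by
        refine (realAverage_mono fun k _ => hk k).trans_eq ?_
        rw [realAverage_add, realAverage_const_mul, realAverage_const]
    _ ≤ 8 * C * (ε / (16 * C)) + ε / 2 := by gcongr
    _ = ε := by field_simp; norm_num

/-! ### Summation along one coordinate -/

theorem boxSize_eq_mul_update (n : Fin d → ℕ) (i : Fin d) :
    boxSize n = ((n i : ℝ) + 1) * boxSize (Function.update n i 0) := by
  rw [boxSize, boxSize, ← Finset.mul_prod_erase _ _ (Finset.mem_univ i),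
    ← Finset.mul_prod_erase _ _ (Finset.mem_univ i)]
  simp only [Function.update_self, Nat.cast_zero, zero_add, one_mul]
  congr 1
  refine Finset.prod_congr rfl fun j hj => ?_
  rw [Function.update_of_ne (Finset.ne_of_mem_erase hj)]

/-- Slices the box into lines in direction `i`. Base points have `i`-th coordinate `0`, so each line
occurs once. One-dimensional estimates enter the multi-parameter averages through this slicing. -/
theorem sum_Icc_eq_sum_fiber {E : Type*} [AddCommMonoid E] (b : (Fin d → ℕ) → E) (n : Fin d → ℕ)
    (i : Fin d) :
    ∑ k ∈ Finset.Icc 0 n, b k = ∑ k ∈ Finset.Icc 0 (Function.update n i 0),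
      ∑ t ∈ Finset.range (n i + 1), b (Function.update k i t) := by
  rw [← Finset.sum_product']
  refine Finset.sum_nbij' (fun k => (Function.update k i 0, k i))
    (fun p => Function.update p.1 i p.2) ?_ ?_ ?_ ?_ ?_
  · intro k hk
    have hk' := (Finset.mem_Icc.1 hk).2
    refine Finset.mem_product.2 ⟨Finset.mem_Icc.2 ⟨fun _ => Nat.zero_le _, ?_⟩, ?_⟩
    · exact update_le_update_iff.2 ⟨le_rfl, fun j _ => hk' j⟩
    · simpa [Nat.lt_succ_iff] using hk' i
  · intro p hp
    obtain ⟨h1, h2⟩ := Finset.mem_product.1 hp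
    have h1' := (Finset.mem_Icc.1 h1).2
    refine Finset.mem_Icc.2 ⟨fun _ => Nat.zero_le _, ?_⟩
    refine update_le_iff.2 ⟨by simpa [Nat.lt_succ_iff] using h2, fun j hj => ?_⟩
    simpa [hj] using h1' j
  · intro k _
    simp
  · intro p hp
    have h1 := (Finset.mem_Icc.1 (Finset.mem_product.1 hp).1).2 i
    have h0 : p.1 i = 0 := by simpa using h1
    refine Prod.ext ?_ (by simp)
    simp only [Function.update_idem]
    rw [← h0, Function.update_eq_self]
  · intro k _
    simp

theorem norm_average_le_of_fiber {b : MultiSeq d} {n : Fin d → ℕ} (i : Fin d) {B : ℝ}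
    (h : ∀ k ≤ Function.update n i 0,
      ‖∑ t ∈ Finset.range (n i + 1), b (Function.update k i t)‖ ≤ B) :
    ‖average b n‖ ≤ B / ((n i : ℝ) + 1) := by
  have hpos := boxSize_pos (Function.update n i 0)
  have hn : (0 : ℝ) < (n i : ℝ) + 1 := by positivity
  rw [average, sum_Icc_eq_sum_fiber b n i, norm_mul, norm_inv, Complex.norm_real,
    Real.norm_of_nonneg (boxSize_pos n).le, boxSize_eq_mul_update n i, inv_mul_le_iff₀
    (by positivity)]
  calc _ ≤ ∑ k ∈ Finset.Icc 0 (Function.update n i 0), B :=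
        norm_sum_le_of_le _ fun k hk => h k (Finset.mem_Icc.1 hk).2
    _ = _ := by
        rw [Finset.sum_const, nsmul_eq_mul, card_Icc_zero]
        field_simp

theorem realAverage_le_of_fiber {f : (Fin d → ℕ) → ℝ} {n : Fin d → ℕ} (i : Fin d) {B : ℝ}
    (h : ∀ k ≤ Function.update n i 0,
      ∑ t ∈ Finset.range (n i + 1), f (Function.update k i t) ≤ B) :
    realAverage f n ≤ B / ((n i : ℝ) + 1) := by
  have hpos := boxSize_pos (Function.update n i 0)
  have hn : (0 : ℝ) < (n i : ℝ) + 1 := by positivity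
  rw [realAverage, sum_Icc_eq_sum_fiber f n i, boxSize_eq_mul_update n i, inv_mul_le_iff₀
    (by positivity)]
  calc _ ≤ ∑ k ∈ Finset.Icc 0 (Function.update n i 0), B :=
        Finset.sum_le_sum fun k hk => h k (Finset.mem_Icc.1 hk).2
    _ = _ := by
        rw [Finset.sum_const, nsmul_eq_mul, card_Icc_zero]
        field_simp

theorem tendsto_const_div_eval_atTop (B : ℝ) (i : Fin d) :
    Tendsto (fun n : Fin d → ℕ => B / ((n i : ℝ) + 1)) atTop (𝓝 0) := by
  have h := (tendsto_one_div_add_atTop_nhds_zero_nat (𝕜 := ℝ)).const_mul B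
  rw [mul_zero] at h
  refine (h.comp (tendsto_eval_atTop i)).congr fun n => ?_
  simp [div_eq_mul_inv]

/-! ### Shifts -/

/-- The inclusion `ℕ^d → ℤ^d`. -/
def toInt (k : Fin d → ℕ) : Fin d → ℤ := fun i => (k i : ℤ)

theorem zeroExtend_toInt (a : MultiSeq d) (k : Fin d → ℕ) : zeroExtend a (toInt k) = a k := by
  simp [zeroExtend, toInt]

theorem zeroExtend_of_not {a : MultiSeq d} {k : Fin d → ℤ} (h : ¬ ∀ i, 0 ≤ k i) :
    zeroExtend a k = 0 := if_neg h

theorem exists_toInt_eq {k : Fin d → ℤ} (h : ∀ i, 0 ≤ k i) : ∃ l : Fin d → ℕ, toInt l = k :=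
  ⟨fun i => (k i).toNat, funext fun i => Int.toNat_of_nonneg (h i)⟩

theorem norm_zeroExtend_le {a : MultiSeq d} {C : ℝ} (ha : ∀ k, ‖a k‖ ≤ C) (k : Fin d → ℤ) :
    ‖zeroExtend a k‖ ≤ C := by
  by_cases h : ∀ i, 0 ≤ k i
  · obtain ⟨l, rfl⟩ := exists_toInt_eq h
    exact (zeroExtend_toInt a l).symm ▸ ha l
  · rw [zeroExtend_of_not h, norm_zero]
    exact (norm_nonneg _).trans (ha 0)

/-- The factor `conj (a k)` vanishes off `ℕ^d`, so only the nonnegative part of the symmetric box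
counts and correlations become means. -/
theorem correlationAverage_eq (a : MultiSeq d) (m : Fin d → ℤ) :
    correlationAverage a m = average fun k => conj (a k) * zeroExtend a (toInt k + m) := by
  funext n
  rw [correlationAverage, average]
  congr 1
  refine (Finset.sum_of_injOn toInt ?_ ?_ ?_ ?_).symm
  · intro k _ l _ h
    exact funext fun i => Int.ofNat.inj (congrFun h i)
  · intro k hk
    have := (Finset.mem_Icc.1 hk).2
    refine Finset.mem_coe.2 (Finset.mem_Icc.2 ⟨fun i => ?_, fun i => ?_⟩)
    · simp only [toInt]
      omega
    · exact Int.ofNat_le.2 (this i)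
  · intro k hk hk'
    rw [zeroExtend_of_not, map_zero, zero_mul]
    intro h
    obtain ⟨l, rfl⟩ := exists_toInt_eq h
    refine hk' ⟨l, Finset.mem_coe.2 (Finset.mem_Icc.2 ⟨fun _ => Nat.zero_le _, fun i => ?_⟩), rfl⟩
    exact Int.ofNat_le.1 ((Finset.mem_Icc.1 hk).2 i)
  · intro k _
    rw [zeroExtend_toInt]

/-- `k + m` lies in the box `[0, n]`. -/
def ShiftsInto (m : Fin d → ℤ) (n k : Fin d → ℕ) : Prop :=
  ∀ i, 0 ≤ (k i : ℤ) + m i ∧ (k i : ℤ) + m i ≤ n i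

open Classical in
/-- The proportion of the points of the box `[0, n]` which leave it under the shift by `m`. -/
noncomputable def leaving (m : Fin d → ℤ) (n : Fin d → ℕ) : ℝ :=
  realAverage (fun k => if ShiftsInto m n k then 0 else 1) n

theorem sum_range_leaving_le (m : ℤ) (n : ℕ) :
    ∑ t ∈ Finset.range (n + 1), (if 0 ≤ (t : ℤ) + m ∧ (t : ℤ) + m ≤ n then (0 : ℝ) else 1) ≤
      m.natAbs := by
  have : ∀ t : ℕ, (if 0 ≤ (t : ℤ) + m ∧ (t : ℤ) + m ≤ n then (0 : ℝ) else 1) =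
      if ¬(0 ≤ (t : ℤ) + m ∧ (t : ℤ) + m ≤ n) then 1 else 0 := fun t => by split_ifs <;> simp_all
  simp only [this]
  rw [Finset.sum_boole, Nat.cast_le]
  rcases le_total 0 m with hm | hm
  · refine (Finset.card_le_card (t := Finset.Ico (n + 1 - m.natAbs) (n + 1)) fun t ht => ?_).trans
      (by rw [Nat.card_Ico]; omega)
    simp only [Finset.mem_filter, Finset.mem_range, Finset.mem_Ico] at ht ⊢
    omega
  · refine (Finset.card_le_card (t := Finset.range m.natAbs) fun t ht => ?_).trans
      (by rw [Finset.card_range])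
    simp only [Finset.mem_filter, Finset.mem_range] at ht ⊢
    omega

/-- A point leaves the box through some coordinate; on each line in direction `i` at most `|m i|`
points do so. -/
theorem leaving_le (m : Fin d → ℤ) (n : Fin d → ℕ) :
    leaving m n ≤ ∑ i, ((m i).natAbs : ℝ) / ((n i : ℝ) + 1) := by
  classical
  let f : Fin d → (Fin d → ℕ) → ℝ := fun i k =>
    if 0 ≤ (k i : ℤ) + m i ∧ (k i : ℤ) + m i ≤ n i then 0 else 1
  have hf : ∀ i k, 0 ≤ f i k := fun i k => by simp only [f]; split_ifs <;> norm_num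
  calc leaving m n ≤ realAverage (fun k => ∑ i, f i k) n := by
        refine realAverage_mono fun k _ => ?_
        split_ifs with h
        · exact Finset.sum_nonneg fun i _ => hf i k
        · obtain ⟨i, hi⟩ := not_forall.1 h
          refine le_trans ?_ (Finset.single_le_sum (fun i _ => hf i k) (Finset.mem_univ i))
          simp only [f]
          rw [if_neg hi]
    _ = ∑ i, realAverage (f i) n := by
        simp only [realAverage, ← Finset.mul_sum]
        rw [Finset.sum_comm]
    _ ≤ _ := by
        refine Finset.sum_le_sum fun i _ => realAverage_le_of_fiber i fun k _ => ?_
        simpa [f] using sum_range_leaving_le (m i) (n i)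

theorem tendsto_leaving (m : Fin d → ℤ) : Tendsto (leaving m) atTop (𝓝 0) := by
  refine squeeze_zero (fun n => realAverage_nonneg (fun k => ?_) n) (leaving_le m) ?_
  · split_ifs <;> norm_num
  · simpa using tendsto_finsetSum Finset.univ fun i _ =>
      tendsto_const_div_eval_atTop ((m i).natAbs : ℝ) i

open Classical in
theorem norm_average_sub_filter_le {b : MultiSeq d} {C : ℝ} (hb : ∀ k, ‖b k‖ ≤ C)
    (m : Fin d → ℤ) (n : Fin d → ℕ) :
    ‖average b n - average (fun k => if ShiftsInto m n k then b k else 0) n‖ ≤ C * leaving m n := by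
  rw [← average_sub, leaving, ← realAverage_const_mul]
  refine (norm_average_le _ n).trans (realAverage_mono fun k _ => ?_)
  split_ifs <;> simp [hb k]

-- Translation by `m` is a bijection from the points of the box that stay inside under `m` onto
-- those that stay inside under `-m`. Discarding the other points costs only a boundary term, so
-- means are shift invariant.
open Classical in
theorem average_shift_filter (b : MultiSeq d) (m : Fin d → ℤ) (n : Fin d → ℕ) :
    average (fun k => if ShiftsInto m n k then zeroExtend b (toInt k + m) else 0) n =
      average (fun k => if ShiftsInto (-m) n k then b k else 0) n := by
  rw [average, average, ← Finset.sum_filter, ← Finset.sum_filter]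
  congr 1
  refine Finset.sum_nbij' (fun k i => ((k i : ℤ) + m i).toNat) (fun k i => ((k i : ℤ) - m i).toNat)
    ?_ ?_ ?_ ?_ ?_
  · intro k hk
    obtain ⟨h1, h2⟩ := Finset.mem_filter.1 hk
    refine Finset.mem_filter.2 ⟨Finset.mem_Icc.2 ⟨fun i => Nat.zero_le _, fun i => ?_⟩, fun i => ?_⟩
    · have := h2 i
      dsimp only
      omega
    · have := h2 i
      have h4 : k i ≤ n i := (Finset.mem_Icc.1 h1).2 i
      dsimp only [Pi.neg_apply]
      omega
  · intro k hk
    obtain ⟨h1, h2⟩ := Finset.mem_filter.1 hk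
    refine Finset.mem_filter.2 ⟨Finset.mem_Icc.2 ⟨fun i => Nat.zero_le _, fun i => ?_⟩, fun i => ?_⟩
    · have := h2 i
      dsimp only [Pi.neg_apply] at this ⊢
      omega
    · have h3 := h2 i
      have h4 : k i ≤ n i := (Finset.mem_Icc.1 h1).2 i
      dsimp only [Pi.neg_apply] at h3 ⊢
      omega
  · intro k hk
    funext i
    have := (Finset.mem_filter.1 hk).2 i
    dsimp only
    omega
  · intro k hk
    funext i
    have := (Finset.mem_filter.1 hk).2 i
    dsimp only [Pi.neg_apply] at this ⊢
    omega
  · intro k hk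
    rw [← zeroExtend_toInt b]
    congr 1
    funext i
    have := (Finset.mem_filter.1 hk).2 i
    simp only [toInt, Pi.add_apply]
    omega

/-- Shifting a bounded sequence does not change its mean. -/
theorem HasMean.shift {b : MultiSeq d} {L : ℂ} (h : HasMean b L) (hb : IsBoundedSeq b)
    (m : Fin d → ℤ) : HasMean (fun k => zeroExtend b (toInt k + m)) L := by
  classical
  obtain ⟨C, hC⟩ := hb
  refine (tendsto_iff_norm_sub_tendsto_zero.2 ?_ : Tendsto (fun n =>
    average (fun k => zeroExtend b (toInt k + m)) n) atTop (𝓝 L))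
  have h0 : Tendsto (fun n => C * leaving m n + C * leaving (-m) n + ‖average b n - L‖) atTop
      (𝓝 0) := by
    simpa using (((tendsto_leaving m).const_mul C).add ((tendsto_leaving (-m)).const_mul C)).add
      (tendsto_iff_norm_sub_tendsto_zero.1 h)
  refine squeeze_zero (fun n => norm_nonneg _) (fun n => ?_) h0
  have h1 := norm_average_sub_filter_le (b := fun k => zeroExtend b (toInt k + m))
    (fun k => norm_zeroExtend_le hC _) m n
  have h2 := norm_average_sub_filter_le hC (-m) n
  rw [average_shift_filter] at h1
  set x := average (fun k => zeroExtend b (toInt k + m)) n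
  set y := average (fun k => if ShiftsInto (-m) n k then b k else 0) n
  calc ‖x - L‖ = ‖(x - y) + (y - average b n) + (average b n - L)‖ := by ring_nf
    _ ≤ _ := norm_add_le_of_le (norm_add_le_of_le h1 (by rwa [norm_sub_rev])) le_rfl

/-! ### Existence and uniqueness of the spectral measure -/

/-- Normalized Haar measure on the torus. -/
noncomputable def torusHaar (d : ℕ) : Measure (Torus d) := Measure.haarMeasure ⊤

instance : IsProbabilityMeasure (torusHaar d) :=
  ⟨by simpa [torusHaar] using
    Measure.haarMeasure_self (K₀ := (⊤ : TopologicalSpace.PositiveCompacts (Torus d)))⟩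

instance : (torusHaar d).IsMulLeftInvariant := by
  unfold torusHaar
  infer_instance

theorem exists_intMonomial_ne_one {m : Fin d → ℤ} (hm : m ≠ 0) :
    ∃ z : Torus d, intMonomial z m ≠ 1 := by
  obtain ⟨i, hi⟩ := Function.ne_iff.1 hm
  -- The `m i`-th power of this point is `exp (π i) = -1`.
  refine ⟨Function.update 1 i (Circle.exp (Real.pi / m i)), ?_⟩
  rw [intMonomial, Finset.prod_eq_single i (fun j _ hj => by simp [hj]) (by simp)]
  have hi' : (m i : ℝ) ≠ 0 := by exact_mod_cast hi
  rw [Function.update_self, ← Circle.coe_zpow, ← Circle.exp_intCast_mul, mul_div_cancel₀ _ hi']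
  exact fun h => Circle.exp_pi_ne_one (Circle.coe_eq_one.1 h)

-- Translating by `w` multiplies the integral by `intMonomial w m`; when this factor is not one,
-- invariance forces the integral to vanish.
open Classical in
theorem integral_intMonomial_haar (m : Fin d → ℤ) :
    ∫ z, intMonomial z m ∂torusHaar d = if m = 0 then 1 else 0 := by
  split_ifs with hm
  · simp [hm, intMonomial_zero]
  · obtain ⟨w, hw⟩ := exists_intMonomial_ne_one hm
    have h := integral_mul_left_eq_self (μ := torusHaar d) (fun z => intMonomial z m) w
    simp only [intMonomial_mul] at h
    rw [integral_const_mul] at h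
    have : (intMonomial w m - 1) * ∫ z, intMonomial z m ∂torusHaar d = 0 := by
      rw [sub_mul, h]; ring
    exact (mul_eq_zero.1 this).resolve_left (sub_ne_zero.2 hw)

theorem continuous_natMonomial (k : Fin d → ℕ) : Continuous fun z : Torus d => natMonomial z k := by
  simpa only [intMonomial_natCast] using continuous_intMonomial (d := d) fun i => (k i : ℤ)

theorem intMonomial_toInt (z : Torus d) (k : Fin d → ℕ) :
    intMonomial z (toInt k) = natMonomial z k := intMonomial_natCast z k

/-- The density `|n + 1|⁻¹ |∑_{0 ≤ k ≤ n} a(k) conj (z)^k|²`. -/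
noncomputable def periodogram (a : MultiSeq d) (n : Fin d → ℕ) (z : Torus d) : ℝ :=
  (boxSize n)⁻¹ * ‖∑ k ∈ Finset.Icc 0 n, a k * conj (natMonomial z k)‖ ^ 2

theorem periodogram_nonneg (a : MultiSeq d) (n : Fin d → ℕ) (z : Torus d) :
    0 ≤ periodogram a n z :=
  mul_nonneg (inv_nonneg.2 (boxSize_pos n).le) (sq_nonneg _)

theorem continuous_periodogram (a : MultiSeq d) (n : Fin d → ℕ) :
    Continuous (periodogram a n) := by
  refine continuous_const.mul ((continuous_finsetSum _ fun k _ => ?_).norm.pow 2)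
  exact continuous_const.mul (Complex.continuous_conj.comp (continuous_natMonomial k))

theorem ofReal_periodogram (a : MultiSeq d) (n : Fin d → ℕ) (z : Torus d) :
    (periodogram a n z : ℂ) = ((boxSize n : ℝ) : ℂ)⁻¹ * ∑ k ∈ Finset.Icc 0 n,
      ∑ l ∈ Finset.Icc 0 n, conj (a k) * a l * intMonomial z (toInt k - toInt l) := by
  rw [periodogram, Complex.ofReal_mul, Complex.ofReal_inv, Complex.ofReal_pow,
    ← Complex.conj_mul', map_sum, Finset.sum_mul_sum]
  congr 1
  refine Finset.sum_congr rfl fun k _ => Finset.sum_congr rfl fun l _ => ?_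
  rw [sub_eq_add_neg, intMonomial_add, intMonomial_neg, intMonomial_toInt, intMonomial_toInt]
  simp only [map_mul, Complex.conj_conj]
  ring

theorem integrable_of_continuous {μ : Measure (Torus d)} [IsFiniteMeasure μ] {f : Torus d → ℂ}
    (hf : Continuous f) : Integrable f μ :=
  hf.integrable_of_hasCompactSupport (HasCompactSupport.of_compactSpace f)

-- Orthogonality leaves only the pairs with `l = k + m`, both in the box. Fourier coefficients of
-- the periodogram are thus correlation averages without their boundary terms.
open Classical in
theorem integral_intMonomial_mul_periodogram (a : MultiSeq d) (n : Fin d → ℕ) (m : Fin d → ℤ) :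
    ∫ z, (periodogram a n z : ℂ) * intMonomial z m ∂torusHaar d = average (fun k =>
      if ShiftsInto m n k then conj (a k) * zeroExtend a (toInt k + m) else 0) n := by
  have h1 : ∀ z : Torus d, (periodogram a n z : ℂ) * intMonomial z m =
      ((boxSize n : ℝ) : ℂ)⁻¹ * ∑ k ∈ Finset.Icc 0 n, ∑ l ∈ Finset.Icc 0 n,
        conj (a k) * a l * intMonomial z (toInt k - toInt l + m) := fun z => by
    simp only [ofReal_periodogram, intMonomial_add, mul_assoc, Finset.sum_mul]
  simp only [h1]
  have hint : ∀ k l, Integrable (fun z : Torus d =>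
      conj (a k) * a l * intMonomial z (toInt k - toInt l + m)) (torusHaar d) := fun k l =>
    integrable_of_continuous (continuous_const.mul (continuous_intMonomial _))
  rw [integral_const_mul, average, integral_finsetSum _ fun k _ =>
    integrable_finsetSum _ fun l _ => hint k l]
  congr 1
  refine Finset.sum_congr rfl fun k hk => ?_
  rw [integral_finsetSum _ fun l _ => hint k l]
  simp only [integral_const_mul, integral_intMonomial_haar]
  split_ifs with h
  · obtain ⟨l, hl⟩ := exists_toInt_eq (k := toInt k + m) fun i => (h i).1
    rw [← hl, zeroExtend_toInt, Finset.sum_eq_single l, if_pos, mul_one]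
    · rw [hl]; abel
    · intro l' _ hne
      rw [if_neg, mul_zero]
      intro h0
      refine hne (funext fun i => ?_)
      have e1 := congrFun h0 i
      have e2 := congrFun hl i
      simp only [toInt, Pi.add_apply, Pi.sub_apply, Pi.zero_apply] at e1 e2
      omega
    · intro hl'
      refine absurd (Finset.mem_Icc.2 ⟨fun _ => Nat.zero_le _, fun i => ?_⟩) hl'
      have e1 := (h i).2
      have e2 := congrFun hl i
      simp only [toInt, Pi.add_apply] at e2
      change l i ≤ n i
      omega
  · refine Finset.sum_eq_zero fun l hl => ?_
    rw [if_neg, mul_zero]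
    intro h0
    refine h fun i => ?_
    have e1 := congrFun h0 i
    have e2 : l i ≤ n i := (Finset.mem_Icc.1 hl).2 i
    simp only [toInt, Pi.add_apply, Pi.sub_apply, Pi.zero_apply] at e1
    omega

/-- The measure with density `periodogram a n` with respect to Haar measure. -/
noncomputable def periodogramMeasure (a : MultiSeq d) (n : Fin d → ℕ) : Measure (Torus d) :=
  (torusHaar d).withDensity fun z => ENNReal.ofReal (periodogram a n z)

theorem integral_periodogramMeasure (a : MultiSeq d) (n : Fin d → ℕ) (f : Torus d → ℂ) :
    ∫ z, f z ∂periodogramMeasure a n = ∫ z, (periodogram a n z : ℂ) * f z ∂torusHaar d := by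
  rw [periodogramMeasure, integral_withDensity_eq_integral_toReal_smul
    (continuous_periodogram a n).measurable.ennreal_ofReal
    (Eventually.of_forall fun _ => ENNReal.ofReal_lt_top)]
  refine integral_congr_ae (Eventually.of_forall fun z => ?_)
  simp [ENNReal.toReal_ofReal (periodogram_nonneg a n z)]

instance (a : MultiSeq d) (n : Fin d → ℕ) : IsFiniteMeasure (periodogramMeasure a n) := by
  refine isFiniteMeasure_withDensity_ofReal ?_
  exact ((continuous_periodogram a n).integrable_of_hasCompactSupport
    (HasCompactSupport.of_compactSpace _)).2

/-- The total mass is the zeroth Fourier coefficient, the average of `‖a‖²`; its uniform bound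
provides the compactness needed for Bochner's theorem. -/
theorem periodogramMeasure_real_univ_le {a : MultiSeq d} {C : ℝ} (ha : ∀ k, ‖a k‖ ≤ C)
    (n : Fin d → ℕ) : (periodogramMeasure a n).real Set.univ ≤ C * C := by
  classical
  have h := integral_periodogramMeasure a n fun z => intMonomial z 0
  rw [integral_intMonomial_mul_periodogram] at h
  simp only [intMonomial_zero, integral_const, add_zero, zeroExtend_toInt] at h
  have h2 : ‖(((periodogramMeasure a n).real Set.univ • (1 : ℂ)))‖ ≤ C * C := by
    rw [h]
    refine norm_average_le_of_bound (fun k => ?_) n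
    have hC : 0 ≤ C := (norm_nonneg _).trans (ha k)
    split_ifs
    · rw [norm_mul, RCLike.norm_conj]
      exact mul_le_mul (ha k) (ha k) (norm_nonneg _) hC
    · simpa using mul_nonneg hC hC
  rw [norm_smul, norm_one, mul_one, Real.norm_of_nonneg measureReal_nonneg] at h2
  exact h2

theorem tendsto_integral_periodogramMeasure {a : MultiSeq d} {γ : (Fin d → ℤ) → ℂ}
    (hγ : IsCorrelation a γ) (ha : IsBoundedSeq a) (m : Fin d → ℤ) :
    Tendsto (fun n => ∫ z, intMonomial z m ∂periodogramMeasure a n) atTop (𝓝 (γ m)) := by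
  classical
  obtain ⟨C, hC⟩ := ha
  have hb : ∀ k, ‖conj (a k) * zeroExtend a (toInt k + m)‖ ≤ C * C := fun k => by
    rw [norm_mul, RCLike.norm_conj]
    exact mul_le_mul (hC k) (norm_zeroExtend_le hC _) (norm_nonneg _)
      ((norm_nonneg _).trans (hC k))
  have h1 : Tendsto (fun n => correlationAverage a m n -
      ∫ z, intMonomial z m ∂periodogramMeasure a n) atTop (𝓝 0) := by
    refine squeeze_zero_norm (a := fun n => C * C * leaving m n) (fun n => ?_) ?_
    · rw [integral_periodogramMeasure, integral_intMonomial_mul_periodogram, correlationAverage_eq]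
      exact norm_average_sub_filter_le hb m n
    · simpa using (tendsto_leaving m).const_mul (C * C)
  simpa using (hγ m).sub h1

/-- **Bochner's theorem** for correlations of bounded sequences. -/
theorem IsCorrelation.exists_isSpectralMeasure {a : MultiSeq d} {γ : (Fin d → ℤ) → ℂ}
    (hγ : IsCorrelation a γ) (ha : IsBoundedSeq a) : ∃ σ, IsSpectralMeasure a σ := by
  obtain ⟨C, hC⟩ := id ha
  let μ : (Fin d → ℕ) → FiniteMeasure (Torus d) := fun n => ⟨periodogramMeasure a n, inferInstance⟩
  -- Measures of mass at most `C * C` on the compact torus form a weakly compact set, so an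
  -- ultrafilter refining `atTop` yields a weak limit. Its Fourier coefficients are read off by
  -- testing against characters.
  let U : Ultrafilter (Fin d → ℕ) := Ultrafilter.of atTop
  obtain ⟨σ, -, hσ⟩ := isCompact_iff_ultrafilter_le_nhds'.1
    (isCompact_setOfPred_finiteMeasure_le_of_compactSpace (Torus d) (C * C).toNNReal) (U.map μ)
    (Filter.mem_map.2 (Filter.univ_mem' fun n => by
      change (μ n).mass ≤ (C * C).toNNReal
      rw [← NNReal.coe_le_coe, Real.coe_toNNReal _ (mul_self_nonneg C)]
      exact periodogramMeasure_real_univ_le hC n))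
  have hσ' : Tendsto μ U (𝓝 σ) := hσ
  refine ⟨σ, inferInstance, fun m => ?_⟩
  have h1 := (FiniteMeasure.tendsto_iff_forall_integral_rclike_tendsto ℂ).1 hσ'
    (BoundedContinuousFunction.mkOfCompact ⟨_, continuous_intMonomial m⟩)
  have h2 := (tendsto_integral_periodogramMeasure hγ ha m).mono_left (Ultrafilter.of_le atTop)
  have h3 : γ m = ∫ z, intMonomial z m ∂(σ : Measure (Torus d)) := tendsto_nhds_unique h2 h1
  exact (hγ m).trans_eq (congrArg 𝓝 h3)

theorem isSpectralMeasure_spectralMeasure {a : MultiSeq d} (h : HasCorrelation a)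
    (ha : IsBoundedSeq a) : IsSpectralMeasure a (spectralMeasure a) := by
  have h' : ∃ σ, IsSpectralMeasure a σ := h.choose_spec.exists_isSpectralMeasure ha
  rw [spectralMeasure, dif_pos h']
  exact h'.choose_spec

/-- The star algebra generated by the monomials. -/
noncomputable def monomialAlgebra (d : ℕ) :
    StarSubalgebra ℂ (BoundedContinuousFunction (Torus d) ℂ) where
  toSubalgebra := Algebra.adjoin ℂ (Set.range fun m : Fin d → ℤ =>
    BoundedContinuousFunction.mkOfCompact ⟨_, continuous_intMonomial m⟩)
  star_mem' := by
    change Algebra.adjoin ℂ _ ≤ star (Algebra.adjoin ℂ _)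
    refine Algebra.adjoin_le ?_
    rintro _ ⟨m, rfl⟩
    refine Algebra.subset_adjoin ⟨-m, ?_⟩
    ext z
    simp [intMonomial_neg]

/-- A finite measure on the torus is determined by its Fourier coefficients. -/
theorem ext_of_integral_intMonomial {μ ν : Measure (Torus d)} [IsFiniteMeasure μ]
    [IsFiniteMeasure ν] (h : ∀ m, ∫ z, intMonomial z m ∂μ = ∫ z, intMonomial z m ∂ν) : μ = ν := by
  refine ext_of_forall_mem_subalgebra_integral_eq_of_polish (𝕜 := ℂ) (A := monomialAlgebra d) ?_ ?_
  · intro x y hxy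
    obtain ⟨i, hi⟩ := Function.ne_iff.1 hxy
    refine ⟨fun z => intMonomial z (Pi.single i 1), ⟨ContinuousMap.mk _ (continuous_intMonomial _),
      ⟨BoundedContinuousFunction.mkOfCompact ⟨_, continuous_intMonomial (Pi.single i 1)⟩,
        Algebra.subset_adjoin ⟨_, rfl⟩, rfl⟩, rfl⟩, ?_⟩
    have : ∀ z : Torus d, intMonomial z (Pi.single i 1) = z i := fun z => by
      rw [intMonomial, Finset.prod_eq_single i (fun j _ hj => by simp [hj]) (by simp)]
      simp
    dsimp only
    rw [this, this]
    exact fun h => hi (Circle.ext h)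
  · intro g hg
    replace hg : g ∈ Subalgebra.toSubmodule (monomialAlgebra d).toSubalgebra := hg
    -- Products of characters are characters, so the generated algebra is their linear span and
    -- linearity of the integral suffices.
    rw [show Subalgebra.toSubmodule (monomialAlgebra d).toSubalgebra = Submodule.span ℂ _ from
      Algebra.adjoin_eq_span_of_subset (R := ℂ) ?_] at hg
    · induction hg using Submodule.span_induction with
      | mem x hx =>
        obtain ⟨m, rfl⟩ := hx
        exact h m
      | zero => simp
      | add x y _ _ hx hy =>
        simp only [BoundedContinuousFunction.coe_add, Pi.add_apply]
        rw [integral_add (integrable_of_continuous x.continuous)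
          (integrable_of_continuous y.continuous), integral_add
          (integrable_of_continuous x.continuous) (integrable_of_continuous y.continuous), hx, hy]
      | smul c x _ hx =>
        simp only [BoundedContinuousFunction.coe_smul]
        rw [integral_smul, integral_smul, hx]
    · refine .trans (fun x => Submonoid.closure_induction (fun _ => id) ⟨0, ?_⟩ ?_)
        Submodule.subset_span
      · ext z
        simp [intMonomial_zero]
      · rintro _ _ _ _ ⟨m, rfl⟩ ⟨n, rfl⟩
        refine ⟨m + n, ?_⟩
        ext z
        simp [intMonomial_add]

/-! ### Atoms of the spectral measure -/

theorem natMonomial_mul_conj (z w : Torus d) (k : Fin d → ℕ) :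
    natMonomial z k * conj (natMonomial w k) = natMonomial (z * w⁻¹) k := by
  rw [natMonomial_mul, natMonomial_inv]

theorem continuous_average_natMonomial (n : Fin d → ℕ) :
    Continuous fun z : Torus d => average (natMonomial z) n :=
  continuous_const.mul (continuous_finsetSum _ fun k _ => continuous_natMonomial k)

/-- Wiener's formula for the atoms of a measure on the torus. -/
theorem hasMean_integral_intMonomial (σ : Measure (Torus d)) [IsFiniteMeasure σ] (w : Torus d) :
    HasMean (fun k => (∫ z, intMonomial z (toInt k) ∂σ) * conj (natMonomial w k))
      (σ.real {w} : ℂ) := by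
  classical
  -- The average moves under the integral and becomes the average of the character `z * w⁻¹`, which
  -- converges boundedly to the indicator of `{w}`.
  have h1 : ∀ n, average (fun k => (∫ z, intMonomial z (toInt k) ∂σ) * conj (natMonomial w k)) n =
      ∫ z, average (natMonomial (z * w⁻¹)) n ∂σ := fun n => by
    simp only [average]
    have hint : ∀ k, Integrable (fun z : Torus d => natMonomial (z * w⁻¹) k) σ := fun k =>
      integrable_of_continuous ((continuous_natMonomial k).comp (continuous_mul_const w⁻¹))
    rw [integral_const_mul, integral_finsetSum _ fun k _ => hint k]
    congr 1
    refine Finset.sum_congr rfl fun k _ => ?_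
    simp only [natMonomial_mul, intMonomial_toInt, natMonomial_inv]
    rw [integral_mul_const]
  have h2 : ((σ.real {w} : ℝ) : ℂ) = ∫ z, (if z * w⁻¹ = 1 then 1 else 0 : ℂ) ∂σ := by
    have : (fun z : Torus d => (if z * w⁻¹ = 1 then 1 else 0 : ℂ)) =
        Set.indicator {w} fun _ => 1 := by
      funext z
      simp [Set.indicator_apply, mul_inv_eq_one]
    rw [this, integral_indicator (measurableSet_singleton w)]
    simp [measureReal_def]
  rw [HasMean, funext h1, h2]
  refine tendsto_integral_filter_of_dominated_convergence (fun _ => 1) ?_ ?_ ?_ ?_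
  · exact Eventually.of_forall fun n =>
      ((continuous_average_natMonomial n).comp (continuous_mul_const w⁻¹)).aestronglyMeasurable
  · exact Eventually.of_forall fun n => Eventually.of_forall fun z =>
      norm_average_le_of_bound (fun k => (norm_natMonomial _ k).le) n
  · exact integrable_const 1
  · exact Eventually.of_forall fun z => hasMean_natMonomial (z * w⁻¹)

/-! ### Amplitudes -/

theorem HasAmplitudeAt.hasMean {a : MultiSeq d} {z : Torus d} (h : HasAmplitudeAt a z) :
    HasMean (fun k => a k * conj (natMonomial z k)) (amplitude a z) :=
  tendsto_nhds_limUnder h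

theorem HasMean.amplitude_eq {a : MultiSeq d} {z : Torus d} {L : ℂ}
    (h : HasMean (fun k => a k * conj (natMonomial z k)) L) : amplitude a z = L :=
  Tendsto.limUnder_eq h

theorem norm_mul_conj_natMonomial (x : ℂ) (z : Torus d) (k : Fin d → ℕ) :
    ‖x * conj (natMonomial z k)‖ = ‖x‖ := by
  rw [norm_mul, RCLike.norm_conj, norm_natMonomial, mul_one]

/-- Orthogonality reads off the coefficient at `z`; writing the polynomial with distinct frequencies
makes that a single value. -/
theorem hasMean_finsupp_mul_conj (c : Torus d →₀ ℂ) (z : Torus d) :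
    HasMean (fun k => (∑ w ∈ c.support, c w * natMonomial w k) * conj (natMonomial z k))
      (c z) := by
  classical
  have h := HasMean.sum (s := c.support) fun w _ =>
    (hasMean_natMonomial (w * z⁻¹)).const_mul (c w)
  have e : ∑ w ∈ c.support, c w * (if w * z⁻¹ = 1 then 1 else 0) = c z := by
    simp only [mul_inv_eq_one, mul_ite, mul_one, mul_zero]
    rw [Finset.sum_ite_eq']
    simpa using fun h => h.symm
  rw [e] at h
  simpa only [Finset.sum_mul, mul_assoc, natMonomial_mul_conj] using h

theorem MeanApprox.hasAmplitude {a : MultiSeq d} (h : MeanApprox a) : HasAmplitude a := by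
  intro z
  refine exists_hasMean_of_approx fun ε hε => ?_
  obtain ⟨P, hP, hPa⟩ := h ε hε
  obtain ⟨c, hc⟩ := hP.exists_finsupp
  refine ⟨fun k => P k * conj (natMonomial z k), ⟨c z, ?_⟩, ?_⟩
  · simpa only [hc] using hasMean_finsupp_mul_conj c z
  · simpa only [← sub_mul, norm_mul_conj_natMonomial] using hPa

theorem norm_amplitude_sub_le {a P : MultiSeq d} {c : Torus d →₀ ℂ} {ε : ℝ}
    (hc : ∀ k, P k = ∑ w ∈ c.support, c w * natMonomial w k)
    (hPa : ∀ᶠ n in atTop, realAverage (fun k => ‖a k - P k‖) n ≤ ε) {z : Torus d}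
    (hz : HasAmplitudeAt a z) : ‖amplitude a z - c z‖ ≤ ε := by
  refine hz.hasMean.norm_sub_le (hasMean_finsupp_mul_conj c z) ?_
  simpa only [← hc, ← sub_mul, norm_mul_conj_natMonomial] using hPa

/-- Quadratic mean distance to a trigonometric polynomial. -/
theorem tendsto_realAverage_sq_sub {a : MultiSeq d} {g : ℝ}
    (hg : Tendsto (realAverage fun k => ‖a k‖ ^ 2) atTop (𝓝 g)) (s : Finset (Torus d))
    (c Γ : Torus d → ℂ)
    (hΓ : ∀ w ∈ s, HasMean (fun k => a k * conj (natMonomial w k)) (Γ w)) :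
    Tendsto (realAverage fun k => ‖a k - ∑ w ∈ s, c w * natMonomial w k‖ ^ 2) atTop
      (𝓝 (g - ∑ w ∈ s, ‖Γ w‖ ^ 2 + ∑ w ∈ s, ‖Γ w - c w‖ ^ 2)) := by
  classical
  rw [← hasMean_ofReal_iff] at hg ⊢
  have h1 := HasMean.sum fun w hw => (hΓ w hw).const_mul (conj (c w))
  have h2 := HasMean.sum fun w hw => (hΓ w hw).star.const_mul (c w)
  have h3 := HasMean.sum (s := s) fun w _ => HasMean.sum (s := s) fun v _ =>
    (hasMean_natMonomial (w * v⁻¹)).const_mul (c w * conj (c v))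
  have h := ((hg.sub h1).sub h2).add h3
  have e1 : ∀ k, ((‖a k - ∑ w ∈ s, c w * natMonomial w k‖ ^ 2 : ℝ) : ℂ) =
      ((‖a k‖ ^ 2 : ℝ) : ℂ) - ∑ w ∈ s, conj (c w) * (a k * conj (natMonomial w k)) -
        ∑ w ∈ s, c w * conj (a k * conj (natMonomial w k)) +
        ∑ w ∈ s, ∑ v ∈ s, c w * conj (c v) * natMonomial (w * v⁻¹) k := fun k => by
    have e : ∑ w ∈ s, ∑ v ∈ s, c w * conj (c v) * natMonomial (w * v⁻¹) k =
        (∑ w ∈ s, c w * natMonomial w k) * conj (∑ w ∈ s, c w * natMonomial w k) := by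
      rw [map_sum, Finset.sum_mul_sum]
      refine Finset.sum_congr rfl fun w _ => Finset.sum_congr rfl fun v _ => ?_
      rw [← natMonomial_mul_conj, map_mul]
      ring
    have e' : ∑ w ∈ s, conj (c w) * (a k * conj (natMonomial w k)) =
        a k * conj (∑ w ∈ s, c w * natMonomial w k) := by
      rw [map_sum, Finset.mul_sum]
      refine Finset.sum_congr rfl fun w _ => ?_
      rw [map_mul]
      ring
    have e'' : ∑ w ∈ s, c w * conj (a k * conj (natMonomial w k)) =
        conj (a k) * ∑ w ∈ s, c w * natMonomial w k := by
      rw [Finset.mul_sum]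
      refine Finset.sum_congr rfl fun w _ => ?_
      rw [map_mul, Complex.conj_conj]
      ring
    rw [e, e', e'']
    push_cast
    rw [← Complex.mul_conj', ← Complex.mul_conj', map_sub]
    ring
  -- Only the diagonal of the double sum survives; then complete the square: `|c|² - 2 Re (conj c Γ)
  -- = |Γ - c|² - |Γ|²`.
  have e2 : ((g - ∑ w ∈ s, ‖Γ w‖ ^ 2 + ∑ w ∈ s, ‖Γ w - c w‖ ^ 2 : ℝ) : ℂ) =
      (g : ℂ) - ∑ w ∈ s, conj (c w) * Γ w - ∑ w ∈ s, c w * conj (Γ w) +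
        ∑ w ∈ s, ∑ v ∈ s, c w * conj (c v) * (if w * v⁻¹ = 1 then 1 else 0) := by
    have e : ∑ w ∈ s, ∑ v ∈ s, c w * conj (c v) * (if w * v⁻¹ = 1 then 1 else 0) =
        ∑ w ∈ s, c w * conj (c w) := by
      refine Finset.sum_congr rfl fun w hw => ?_
      simp [mul_inv_eq_one, hw]
    rw [e]
    push_cast
    rw [sub_add, sub_sub, sub_add, ← Finset.sum_sub_distrib, ← Finset.sum_add_distrib,
      ← Finset.sum_sub_distrib]
    congr 1
    refine Finset.sum_congr rfl fun w _ => ?_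
    rw [← Complex.mul_conj', ← Complex.mul_conj', map_sub]
    ring
  rw [e2, funext e1]
  exact h

/-! ### Correlations of sequences approximable in mean -/

theorem zeroExtend_mul_conj (a : MultiSeq d) (w : Torus d) (l : Fin d → ℤ) :
    zeroExtend (fun k => a k * conj (natMonomial w k)) l =
      zeroExtend a l * conj (intMonomial w l) := by
  by_cases h : ∀ i, 0 ≤ l i
  · obtain ⟨k, rfl⟩ := exists_toInt_eq h
    rw [zeroExtend_toInt, zeroExtend_toInt, intMonomial_toInt]
  · rw [zeroExtend_of_not h, zeroExtend_of_not h, zero_mul]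

/-- Write `conj (w^k) = w^m conj (w^(k+m))`; what remains is a shift of the sequence defining the
amplitude. -/
theorem HasAmplitudeAt.hasMean_shift {a : MultiSeq d} {w : Torus d} (h : HasAmplitudeAt a w)
    (ha : IsBoundedSeq a) (m : Fin d → ℤ) :
    HasMean (fun k => conj (natMonomial w k) * zeroExtend a (toInt k + m))
      (intMonomial w m * amplitude a w) := by
  have hb : IsBoundedSeq fun k => a k * conj (natMonomial w k) := by
    obtain ⟨C, hC⟩ := ha
    exact ⟨C, fun k => (norm_mul_conj_natMonomial _ _ _).trans_le (hC k)⟩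
  convert (h.hasMean.shift hb m).const_mul (intMonomial w m) using 2 with k
  have h1 : intMonomial w m * conj (intMonomial w m) = 1 := by
    rw [Complex.mul_conj', norm_intMonomial]
    norm_num
  rw [zeroExtend_mul_conj, intMonomial_add, intMonomial_toInt, map_mul]
  linear_combination (-(conj (natMonomial w k) * zeroExtend a (toInt k + m))) * h1

theorem hasMean_conj_trigPoly_mul_shift {a P : MultiSeq d} {c : Torus d →₀ ℂ}
    (hc : ∀ k, P k = ∑ w ∈ c.support, c w * natMonomial w k) (h : HasAmplitude a)
    (ha : IsBoundedSeq a) (m : Fin d → ℤ) :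
    HasMean (fun k => conj (P k) * zeroExtend a (toInt k + m))
      (∑ w ∈ c.support, conj (c w) * (intMonomial w m * amplitude a w)) := by
  have := HasMean.sum (s := c.support) fun w _ => ((h w).hasMean_shift ha m).const_mul (conj (c w))
  simpa only [hc, map_sum, map_mul, Finset.sum_mul, mul_assoc] using this

/-- Only the unshifted factor is replaced; the shifted one is merely bounded by `C`. The error does
not depend on `m`, so it survives averaging over `m` in Wiener's formula. -/
theorem eventually_realAverage_correlation_sub_le {a P : MultiSeq d} {C ε : ℝ}
    (ha : ∀ k, ‖a k‖ ≤ C)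
    (hPa : ∀ᶠ n in atTop, realAverage (fun k => ‖a k - P k‖) n ≤ ε) (m : Fin d → ℤ) :
    ∀ᶠ n in atTop, realAverage (fun k => ‖conj (a k) * zeroExtend a (toInt k + m) -
      conj (P k) * zeroExtend a (toInt k + m)‖) n ≤ C * ε := by
  have hC : 0 ≤ C := (norm_nonneg _).trans (ha 0)
  refine hPa.mono fun n hn => le_trans ?_ (mul_le_mul_of_nonneg_left hn hC)
  rw [← realAverage_const_mul]
  refine realAverage_mono fun k _ => ?_
  rw [← sub_mul, ← map_sub, norm_mul, RCLike.norm_conj, mul_comm]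
  exact mul_le_mul_of_nonneg_right (norm_zeroExtend_le ha _) (norm_nonneg _)

theorem MeanApprox.hasCorrelation {a : MultiSeq d} (h : MeanApprox a) (ha : IsBoundedSeq a) :
    HasCorrelation a := by
  have : ∀ m, ∃ L, Tendsto (correlationAverage a m) atTop (𝓝 L) := fun m => by
    simp only [correlationAverage_eq]
    refine exists_hasMean_of_approx fun ε hε => ?_
    obtain ⟨C₀, hC₀⟩ := ha
    have hC : ∀ k, ‖a k‖ ≤ |C₀| + 1 := fun k => (hC₀ k).trans (by linarith [le_abs_self C₀])
    obtain ⟨P, hP, hPa⟩ := h (ε / (|C₀| + 1)) (by positivity)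
    obtain ⟨c, hc⟩ := hP.exists_finsupp
    refine ⟨_, ⟨_, hasMean_conj_trigPoly_mul_shift hc h.hasAmplitude ⟨C₀, hC₀⟩ m⟩, ?_⟩
    have := eventually_realAverage_correlation_sub_le hC hPa m
    rwa [mul_div_cancel₀ _ (by positivity)] at this
  choose γ hγ using this
  exact ⟨γ, hγ⟩

/-! ### Atoms and discreteness for sequences approximable in mean -/

theorem IsSpectralMeasure.hasMean {a : MultiSeq d} {σ : Measure (Torus d)}
    (h : IsSpectralMeasure a σ) (m : Fin d → ℤ) :
    HasMean (fun k => conj (a k) * zeroExtend a (toInt k + m)) (∫ z, intMonomial z m ∂σ) := by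
  have := h.2 m
  rwa [correlationAverage_eq] at this

theorem IsSpectralMeasure.tendsto_realAverage_sq {a : MultiSeq d} {σ : Measure (Torus d)}
    (h : IsSpectralMeasure a σ) :
    Tendsto (realAverage fun k => ‖a k‖ ^ 2) atTop (𝓝 (σ.real Set.univ)) := by
  have := h.hasMean 0
  simp only [intMonomial_zero, integral_const, add_zero, zeroExtend_toInt, Complex.conj_mul'] at this
  rw [← hasMean_ofReal_iff]
  simpa using this

theorem eq_of_forall_norm_sub_le {x y : ℂ} {B : ℝ}
    (h : ∀ ε : ℝ, 0 < ε → ‖x - y‖ ≤ B * ε) : x = y := by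
  have hB : Tendsto (fun ε : ℝ => B * ε) (𝓝[>] 0) (𝓝 0) := by
    have : Tendsto (fun ε : ℝ => B * ε) (𝓝 0) (𝓝 (B * 0)) := tendsto_id.const_mul B
    rw [mul_zero] at this
    exact this.mono_left nhdsWithin_le_nhds
  have := ge_of_tendsto hB (eventually_mem_nhdsWithin.mono fun ε hε => h ε hε)
  exact sub_eq_zero.1 (norm_le_zero_iff.1 this)

theorem MeanApprox.atoms {a : MultiSeq d} (h : MeanApprox a) (ha : IsBoundedSeq a)
    {σ : Measure (Torus d)} (hσ : IsSpectralMeasure a σ) (z : Torus d) :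
    σ.real {z} = ‖amplitude a z‖ ^ 2 := by
  have := hσ.1
  obtain ⟨C, hC⟩ := id ha
  have hamp := h.hasAmplitude
  have hΓ : ‖amplitude a z‖ ≤ C :=
    (hamp z).hasMean.norm_le fun k => (norm_mul_conj_natMonomial _ _ _).trans_le (hC k)
  have key : ((σ.real {z} : ℝ) : ℂ) = conj (amplitude a z) * amplitude a z := by
    -- One `C * ε` comes from replacing `a` by `P` in every correlation, the other from replacing `c
    -- z` by the amplitude.
    refine eq_of_forall_norm_sub_le (B := C + C) fun ε hε => ?_
    obtain ⟨P, hP, hPa⟩ := h ε hε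
    obtain ⟨c, hc⟩ := hP.exists_finsupp
    have h1 : HasMean (fun k => (∑ w ∈ c.support, conj (c w) * (intMonomial w (toInt k) *
        amplitude a w)) * conj (natMonomial z k)) (conj (c z) * amplitude a z) := by
      classical
      have := HasMean.sum (s := c.support) fun w _ =>
        (hasMean_natMonomial (w * z⁻¹)).const_mul (conj (c w) * amplitude a w)
      have e : ∑ w ∈ c.support, conj (c w) * amplitude a w * (if w * z⁻¹ = 1 then 1 else 0) =
          conj (c z) * amplitude a z := by
        simp only [mul_inv_eq_one, mul_ite, mul_one, mul_zero]
        rw [Finset.sum_ite_eq']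
        split_ifs with hz
        · rfl
        · rw [Finsupp.notMem_support_iff.1 hz, map_zero, zero_mul]
      rw [e] at this
      convert this using 2 with k
      rw [Finset.sum_mul]
      refine Finset.sum_congr rfl fun w _ => ?_
      rw [← natMonomial_mul_conj, intMonomial_toInt]
      ring
    have h2 := (hasMean_integral_intMonomial σ z).norm_sub_le h1 (ε := C * ε)
      (Eventually.of_forall fun n => (realAverage_mono (g := fun _ => C * ε) fun k _ => ?_).trans_eq
        (realAverage_const _ n))
    · have h3 : ‖conj (c z) * amplitude a z - conj (amplitude a z) * amplitude a z‖ ≤ C * ε := by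
        rw [← sub_mul, ← map_sub, norm_mul, RCLike.norm_conj, norm_sub_rev, mul_comm]
        exact mul_le_mul hΓ (norm_amplitude_sub_le hc hPa (hamp z)) (norm_nonneg _)
          ((norm_nonneg _).trans hΓ)
      rw [add_mul]
      exact norm_sub_le_norm_sub_add_norm_sub _ _ _ |>.trans (add_le_add h2 h3)
    · rw [← sub_mul, norm_mul_conj_natMonomial]
      exact (hσ.hasMean _).norm_sub_le (hasMean_conj_trigPoly_mul_shift hc hamp ha _)
        (eventually_realAverage_correlation_sub_le hC hPa _)
  rw [Complex.conj_mul'] at key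
  exact_mod_cast key

theorem measureReal_compl_finset {σ : Measure (Torus d)} [IsFiniteMeasure σ] {Γ : Torus d → ℂ}
    (hΓ : ∀ z, σ.real {z} = ‖Γ z‖ ^ 2) (s : Finset (Torus d)) :
    σ.real (s : Set (Torus d))ᶜ = σ.real Set.univ - ∑ w ∈ s, ‖Γ w‖ ^ 2 := by
  rw [measureReal_compl s.measurableSet, ← sum_measureReal_singleton]
  simp only [hΓ]

/-- By the Pythagorean identity, the mass missed by the frequencies of `P` is at most the quadratic
mean error of `P`. The union of these finite sets over errors tending to zero carries `σ`. -/
theorem MeanApprox.isDiscreteMeasure {a : MultiSeq d} (h : MeanApprox a) (ha : IsBoundedSeq a)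
    {σ : Measure (Torus d)} (hσ : IsSpectralMeasure a σ) : IsDiscreteMeasure σ := by
  have := hσ.1
  have key : ∀ n : ℕ, ∃ s : Finset (Torus d),
      σ.real (s : Set (Torus d))ᶜ ≤ 1 / ((n : ℝ) + 1) := fun n => by
    obtain ⟨P, hP, hPa⟩ := h.exists_sq ha (ε := 1 / ((n : ℝ) + 1)) (by positivity)
    obtain ⟨c, hc⟩ := hP.exists_finsupp
    refine ⟨c.support, ?_⟩
    simp only [hc] at hPa
    have h1 := le_of_tendsto (tendsto_realAverage_sq_sub hσ.tendsto_realAverage_sq c.support c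
      (amplitude a) fun w _ => (h.hasAmplitude w).hasMean) hPa
    rw [measureReal_compl_finset (h.atoms ha hσ)]
    have h2 : 0 ≤ ∑ w ∈ c.support, ‖amplitude a w - c w‖ ^ 2 :=
      Finset.sum_nonneg fun _ _ => sq_nonneg _
    linarith
  choose s hs using key
  refine ⟨⋃ n, (s n : Set (Torus d)), Set.countable_iUnion fun n => (s n).countable_toSet, ?_⟩
  rw [← measureReal_eq_zero_iff]
  refine le_antisymm (ge_of_tendsto' (tendsto_one_div_add_atTop_nhds_zero_nat (𝕜 := ℝ)) fun n => ?_)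
    measureReal_nonneg
  refine (measureReal_mono ?_).trans (hs n)
  exact Set.compl_subset_compl.2 (Set.subset_iUnion (fun n => (s n : Set (Torus d))) n)

/-! ### From atoms and amplitudes back to approximation in mean -/

theorem IsDiscreteMeasure.exists_finset {σ : Measure (Torus d)} [IsFiniteMeasure σ]
    (h : IsDiscreteMeasure σ) {ε : ℝ} (hε : 0 < ε) :
    ∃ s : Finset (Torus d), σ.real (s : Set (Torus d))ᶜ ≤ ε := by
  classical
  obtain ⟨s, hs, h0⟩ := h
  rcases s.eq_empty_or_nonempty with rfl | hne
  · refine ⟨∅, ?_⟩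
    rw [Finset.coe_empty, measureReal_def, h0]
    simpa using hε.le
  obtain ⟨f, rfl⟩ := hs.exists_eq_range hne
  let t : ℕ → Finset (Torus d) := fun n => (Finset.range n).image f
  have hanti : Antitone fun n => ((t n : Set (Torus d)))ᶜ := fun m n hmn =>
    Set.compl_subset_compl.2 (Finset.coe_subset.2
      (Finset.image_subset_image (Finset.range_subset_range.2 hmn)))
  have hinter : ⋂ n, ((t n : Set (Torus d)))ᶜ = (Set.range f)ᶜ := by
    rw [← Set.compl_iUnion]
    congr 1
    ext x
    simp only [t, Set.mem_iUnion, Finset.mem_coe, Finset.mem_image, Finset.mem_range,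
      Set.mem_range]
    exact ⟨fun ⟨n, j, _, hj⟩ => ⟨j, hj⟩, fun ⟨j, hj⟩ => ⟨j + 1, j, j.lt_succ_self, hj⟩⟩
  have hlim := tendsto_measure_iInter_atTop (μ := σ)
    (fun n => (t n).measurableSet.compl.nullMeasurableSet) hanti ⟨0, measure_ne_top _ _⟩
  rw [hinter, h0] at hlim
  obtain ⟨n, hn⟩ := (hlim.eventually_lt_const (ENNReal.ofReal_pos.2 hε)).exists
  exact ⟨t n, ENNReal.toReal_le_of_le_ofReal hε.le hn.le⟩

theorem meanApprox_of_atoms {a : MultiSeq d} {σ : Measure (Torus d)} (hσ : IsSpectralMeasure a σ)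
    (hd : IsDiscreteMeasure σ) (hamp : HasAmplitude a)
    (hat : ∀ z, σ.real {z} = ‖amplitude a z‖ ^ 2) : MeanApprox a := by
  intro ε hε
  have := hσ.1
  -- With the amplitudes as coefficients the quadratic error tends to the mass off `s`. Asking for
  -- `ε ^ 2 / 2` keeps this limit strictly below `ε ^ 2`.
  obtain ⟨s, hs⟩ := hd.exists_finset (show 0 < ε ^ 2 / 2 by positivity)
  rw [measureReal_compl_finset hat] at hs
  refine ⟨_, isTrigPoly_sum s (amplitude a), ?_⟩
  have hlim := tendsto_realAverage_sq_sub hσ.tendsto_realAverage_sq s (amplitude a)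
      (amplitude a) fun w _ => (hamp w).hasMean
  have hlt : σ.real Set.univ - ∑ w ∈ s, ‖amplitude a w‖ ^ 2 +
      ∑ w ∈ s, ‖amplitude a w - amplitude a w‖ ^ 2 < ε ^ 2 := by
    have : 0 < ε ^ 2 := by positivity
    simp only [sub_self, norm_zero, ne_eq, OfNat.ofNat_ne_zero, not_false_eq_true, zero_pow,
      Finset.sum_const_zero]
    linarith
  refine (hlim.eventually_lt_const hlt).mono fun n hn => ?_
  exact le_of_sq_le_sq ((sq_realAverage_le _ n).trans hn.le) hε.le

theorem isBoundedBesicovitch_iff (a : MultiSeq d) : IsBoundedBesicovitch a ↔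
    BoundedDiscreteSpectrum a ∧ HasAmplitude a ∧ AtomsEqAmplitudeSq a := by
  constructor
  · rintro ⟨h, ha⟩
    have hm := h.meanApprox
    have hσ := isSpectralMeasure_spectralMeasure (hm.hasCorrelation ha) ha
    exact ⟨⟨hm.hasCorrelation ha, ha, hm.isDiscreteMeasure ha hσ⟩, hm.hasAmplitude,
      hm.atoms ha hσ⟩
  · rintro ⟨⟨hcor, ha, hd⟩, hamp, hat⟩
    exact ⟨(meanApprox_of_atoms (isSpectralMeasure_spectralMeasure hcor ha) hd hamp
      hat).isBesicovitch, ha⟩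

/-! ### The sequence `(-1)^⌊√(k_1 + ⋯ + k_d)⌋` -/

theorem nat_sqrt_add_le (x y : ℕ) : (x + y).sqrt ≤ x.sqrt + y.sqrt + 1 := by
  refine Nat.lt_succ_iff.1 (Nat.sqrt_lt.2 ?_)
  have h1 := Nat.lt_succ_sqrt x
  have h2 := Nat.lt_succ_sqrt y
  simp only [Nat.succ_eq_add_one] at *
  nlinarith

theorem nat_sqrt_cast_le {x n : ℕ} {C : ℝ} (h : (x : ℝ) ≤ C * ((n : ℝ) + 1)) :
    (x.sqrt : ℝ) ≤ √C * √((n : ℝ) + 1) := by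
  rw [← Real.sqrt_mul' _ (by positivity)]
  exact (Real.nat_sqrt_le_real_sqrt).trans (Real.sqrt_le_sqrt h)

theorem one_le_sqrt_cast_add_one (n : ℕ) : 1 ≤ √((n : ℝ) + 1) :=
  Real.one_le_sqrt.2 (by linarith [(Nat.cast_nonneg n : (0 : ℝ) ≤ n)])

theorem tendsto_const_div_sqrt_atTop (A : ℝ) (i : Fin d) :
    Tendsto (fun n : Fin d → ℕ => A / √((n i : ℝ) + 1)) atTop (𝓝 0) := by
  refine Tendsto.const_div_atTop (Real.tendsto_sqrt_atTop.comp ?_) A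
  exact tendsto_atTop_add_const_right _ _
    (tendsto_natCast_atTop_atTop.comp (tendsto_eval_atTop i))

theorem mul_sqrt_div_self (A : ℝ) (n : ℕ) :
    A * √((n : ℝ) + 1) / ((n : ℝ) + 1) = A / √((n : ℝ) + 1) := by
  rw [mul_div_assoc, Real.sqrt_div_self, ← div_eq_mul_inv]

/-- Bounds a sign change by the increment of the exponent, which telescopes when summed. -/
theorem norm_neg_one_pow_sub_le {p q : ℕ} (h : p ≤ q) :
    ‖((-1) ^ q - (-1) ^ p : ℂ)‖ ≤ 2 * ((q : ℝ) - p) := by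
  rcases h.eq_or_lt with rfl | h
  · simp
  · have h1 : (p : ℝ) + 1 ≤ q := by exact_mod_cast h
    calc ‖((-1) ^ q - (-1) ^ p : ℂ)‖ ≤ ‖((-1) ^ q : ℂ)‖ + ‖((-1) ^ p : ℂ)‖ := norm_sub_le _ _
      _ = 2 := by norm_num
      _ ≤ _ := by linarith

/-- A shift by `L` is a chain of `L` unit shifts; each telescopes to an increment of `g` over a
window of length `N`. -/
theorem sum_range_shift_sub_le {g : ℕ → ℝ} (hg : Monotone g) (N L : ℕ) :
    ∑ t ∈ Finset.range N, (g (t + L) - g t) ≤ L * (g (N + L) - g 0) := by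
  induction L with
  | zero => simp
  | succ L ih =>
    have h1 : ∑ t ∈ Finset.range N, (g (t + (L + 1)) - g t) =
        ∑ t ∈ Finset.range N, (g (t + L) - g t) + (g (N + L) - g L) := by
      have := Finset.sum_range_sub (fun t => g (t + L)) N
      rw [zero_add] at this
      rw [← this, ← Finset.sum_add_distrib]
      refine Finset.sum_congr rfl fun t _ => ?_
      rw [show t + (L + 1) = t + 1 + L by ring]
      ring
    have h2 : g 0 ≤ g L := hg (Nat.zero_le _)
    have h3 : g (N + L) ≤ g (N + (L + 1)) := hg (by omega)
    have h4 : (L : ℝ) * (g (N + L) - g 0) ≤ L * (g (N + (L + 1)) - g 0) := by gcongr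
    rw [h1]
    push_cast
    linarith

/-- Partial sums of `(-1)^⌊√t⌋`. -/
theorem sum_range_neg_one_pow_sqrt (x : ℕ) :
    ∑ t ∈ Finset.range x, (-1 : ℤ) ^ t.sqrt =
      (-1) ^ x.sqrt * ((x : ℤ) - (x.sqrt : ℤ) * x.sqrt - x.sqrt) := by
  induction x with
  | zero => simp
  | succ x ih =>
    rw [Finset.sum_range_succ, ih]
    have h1 := Nat.sqrt_le x
    have h2 := Nat.lt_succ_sqrt x
    simp only [Nat.succ_eq_add_one] at h2
    -- The integer square root jumps, and the sign flips, exactly when `x + 1` is the next perfect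
    -- square.
    by_cases h : x + 1 = (x.sqrt + 1) * (x.sqrt + 1)
    · have h3 : (x + 1).sqrt = x.sqrt + 1 := by rw [h, Nat.sqrt_eq]
      rw [h3]
      have h4 : (x : ℤ) = (x.sqrt + 1) * (x.sqrt + 1) - 1 := by
        have : ((x + 1 : ℕ) : ℤ) = ((x.sqrt + 1) * (x.sqrt + 1) : ℕ) := congrArg _ h
        push_cast at this
        linarith
      push_cast
      generalize (x.sqrt : ℤ) = J at *
      generalize (x.sqrt : ℕ) = K at *
      rw [h4, pow_succ]
      ring
    · have h3 : (x + 1).sqrt = x.sqrt := by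
        refine le_antisymm (Nat.lt_succ_iff.1 (Nat.sqrt_lt.2 ?_)) (Nat.sqrt_le_sqrt x.le_succ)
        simp only [Nat.succ_eq_add_one]
        omega
      rw [h3]
      push_cast
      ring

/-- With `J = x.sqrt`, the offset `x - J²` lies in `[0, 2J]`, so the closed form has modulus at most
`J`. -/
theorem norm_sum_range_neg_one_pow_sqrt_le (x : ℕ) :
    ‖∑ t ∈ Finset.range x, (-1 : ℂ) ^ t.sqrt‖ ≤ x.sqrt := by
  have h : ∑ t ∈ Finset.range x, (-1 : ℂ) ^ t.sqrt =
      ((∑ t ∈ Finset.range x, (-1 : ℤ) ^ t.sqrt : ℤ) : ℂ) := by push_cast; rfl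
  rw [h, sum_range_neg_one_pow_sqrt, Complex.norm_intCast]
  have h1 := Nat.sqrt_le x
  have h2 := Nat.sqrt_le_add x
  have h3 : |(x : ℤ) - (x.sqrt : ℤ) * x.sqrt - x.sqrt| ≤ x.sqrt := by
    zify at h1 h2
    exact abs_le.2 ⟨by linarith, by linarith⟩
  have h4 : |(-1 : ℤ) ^ x.sqrt * ((x : ℤ) - (x.sqrt : ℤ) * x.sqrt - x.sqrt)| ≤ x.sqrt := by
    rwa [abs_mul, abs_neg_one_pow, one_mul]
  exact_mod_cast h4

/-- Summation by parts for `(-1)^⌊√(c + t)⌋ w^t`. -/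
theorem norm_sum_range_neg_one_pow_sqrt_mul_pow_le (c N : ℕ) {w : ℂ} (hw : ‖w‖ = 1) :
    ‖w - 1‖ * ‖∑ t ∈ Finset.range N, (-1 : ℂ) ^ (c + t).sqrt * w ^ t‖ ≤ 2 * N.sqrt + 4 := by
  let e : ℕ → ℂ := fun t => (-1) ^ (c + t).sqrt
  have he : ∀ t, ‖e t‖ = 1 := fun t => by simp [e]
  have h1 : (w - 1) * ∑ t ∈ Finset.range N, e t * w ^ t =
      e N * w ^ N - e 0 - ∑ t ∈ Finset.range N, (e (t + 1) - e t) * w ^ (t + 1) := by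
    have := Finset.sum_range_sub (fun t => e t * w ^ t) N
    rw [pow_zero, mul_one] at this
    rw [← this, Finset.mul_sum, ← Finset.sum_sub_distrib]
    refine Finset.sum_congr rfl fun t _ => ?_
    ring
  -- The total variation of the sign is at most twice the growth of `⌊√·⌋` from `c` to `c + N`,
  -- which is bounded independently of `c`.
  have h2 : ‖∑ t ∈ Finset.range N, (e (t + 1) - e t) * w ^ (t + 1)‖ ≤ 2 * (N.sqrt + 1) := by
    calc _ ≤ ∑ t ∈ Finset.range N, 2 * (((c + (t + 1)).sqrt : ℝ) - (c + t).sqrt) := by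
          refine norm_sum_le_of_le _ fun t _ => ?_
          rw [norm_mul, norm_pow, hw, one_pow, mul_one]
          exact norm_neg_one_pow_sub_le (Nat.sqrt_le_sqrt (by omega))
      _ = 2 * (((c + N).sqrt : ℝ) - c.sqrt) := by
          rw [← Finset.mul_sum, Finset.sum_range_sub (fun t => ((c + t).sqrt : ℝ)) N, add_zero]
      _ ≤ _ := by
          have : ((c + N).sqrt : ℝ) ≤ c.sqrt + N.sqrt + 1 := by exact_mod_cast nat_sqrt_add_le c N
          linarith
  rw [← norm_mul, h1]
  calc _ ≤ ‖e N * w ^ N‖ + ‖e 0‖ + 2 * (N.sqrt + 1) :=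
        norm_sub_le_of_le (norm_sub_le _ _) h2
    _ = _ := by
        rw [norm_mul, he, he, norm_pow, hw]
        ring

/-! ### Amplitudes and correlation of the sign sequence -/

theorem sum_update (k : Fin d → ℕ) (i : Fin d) (t : ℕ) :
    ∑ j, Function.update k i t j = (∑ j ∈ Finset.univ \ {i}, k j) + t := by
  rw [Finset.sum_update_of_mem (Finset.mem_univ i), add_comm]

theorem norm_sqrtSignSeq (k : Fin d → ℕ) : ‖sqrtSignSeq d k‖ = 1 := by
  simp [sqrtSignSeq]

theorem isBoundedSeq_sqrtSignSeq : IsBoundedSeq (sqrtSignSeq d) :=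
  ⟨1, fun k => (norm_sqrtSignSeq k).le⟩

theorem natMonomial_update (z : Torus d) (k : Fin d → ℕ) (i : Fin d) (t : ℕ) :
    natMonomial z (Function.update k i t) =
      natMonomial z (Function.update k i 0) * (z i : ℂ) ^ t := by
  rw [natMonomial, natMonomial, ← Finset.mul_prod_erase _ _ (Finset.mem_univ i),
    ← Finset.mul_prod_erase _ _ (Finset.mem_univ i)]
  simp only [Function.update_self, pow_zero, one_mul]
  rw [mul_comm]
  congr 1
  refine Finset.prod_congr rfl fun j hj => ?_
  rw [Function.update_of_ne (Finset.ne_of_mem_erase hj),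
    Function.update_of_ne (Finset.ne_of_mem_erase hj)]

/-- Sum by parts along a coordinate with `z i ≠ 1`; the bound is uniform in the other coordinates,
so their relative sizes do not matter. -/
theorem hasMean_sqrtSignSeq_mul_of_ne {z : Torus d} (hz : z ≠ 1) :
    HasMean (fun k => sqrtSignSeq d k * conj (natMonomial z k)) 0 := by
  obtain ⟨i, hi⟩ := Function.ne_iff.1 hz
  let w : ℂ := conj (z i : ℂ)
  have hw : ‖w‖ = 1 := by rw [RCLike.norm_conj, Circle.norm_coe]
  have hw1 : 0 < ‖w - 1‖ := by
    refine norm_pos_iff.2 (sub_ne_zero.2 fun h => hi (Circle.coe_eq_one.1 ?_))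
    simpa [w] using congrArg conj h
  refine squeeze_zero_norm (fun n => ?_) (tendsto_const_div_sqrt_atTop ((2 * √1 + 4) / ‖w - 1‖) i)
  rw [← mul_sqrt_div_self]
  refine norm_average_le_of_fiber i fun k _ => ?_
  have h1 : ∑ t ∈ Finset.range (n i + 1), sqrtSignSeq d (Function.update k i t) *
      conj (natMonomial z (Function.update k i t)) = conj (natMonomial z (Function.update k i 0)) *
      ∑ t ∈ Finset.range (n i + 1),
        (-1 : ℂ) ^ ((∑ j ∈ Finset.univ \ {i}, k j) + t).sqrt * w ^ t := by
    rw [Finset.mul_sum]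
    refine Finset.sum_congr rfl fun t _ => ?_
    rw [sqrtSignSeq, sum_update, natMonomial_update, map_mul, map_pow]
    ring
  rw [h1, norm_mul, RCLike.norm_conj, norm_natMonomial, one_mul, div_mul_eq_mul_div,
    le_div_iff₀ hw1, mul_comm]
  refine (norm_sum_range_neg_one_pow_sqrt_mul_pow_le _ _ hw).trans ?_
  have h2 := nat_sqrt_cast_le (x := n i + 1) (n := n i) (C := 1) (by simp)
  linarith [one_le_sqrt_cast_add_one (n i)]

theorem hasMean_sqrtSignSeq (hd : 0 < d) : HasMean (sqrtSignSeq d) 0 := by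
  have : Nonempty (Fin d) := ⟨⟨0, hd⟩⟩
  let i₀ : Fin d := ⟨0, hd⟩
  refine squeeze_zero_norm (fun n => ?_) (tendsto_const_div_sqrt_atTop (2 * √(d + 1)) i₀)
  -- Without a character the line sums are controlled only by the square root of the offset `c`.
  -- Along the longest side `c ≤ d * n i`, so they are of order `√(n i)`. The final bound uses the
  -- fixed index `i₀`, as `i` varies with `n`.
  obtain ⟨i, hi⟩ := Finite.exists_max n
  have h0 : 2 * √((d : ℝ) + 1) / √((n i : ℝ) + 1) ≤ 2 * √(d + 1) / √((n i₀ : ℝ) + 1) := by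
    have : (n i₀ : ℝ) ≤ n i := by exact_mod_cast hi i₀
    gcongr
  refine le_trans ?_ h0
  rw [← mul_sqrt_div_self]
  refine norm_average_le_of_fiber i fun k hk => ?_
  set c := ∑ j ∈ Finset.univ \ {i}, k j
  have hc : c ≤ d * n i := by
    calc c ≤ ∑ j ∈ Finset.univ \ {i}, n i := by
          refine Finset.sum_le_sum fun j hj => ?_
          have hji : j ≠ i := by simpa using hj
          have h := hk j
          rw [Function.update_of_ne hji] at h
          exact h.trans (hi j)
      _ ≤ d * n i := by
          rw [Finset.sum_const, smul_eq_mul]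
          exact Nat.mul_le_mul_right _ ((Finset.card_le_univ _).trans_eq (Fintype.card_fin d))
  have h1 : ∑ t ∈ Finset.range (n i + 1), sqrtSignSeq d (Function.update k i t) =
      ∑ t ∈ Finset.range (c + (n i + 1)), (-1 : ℂ) ^ t.sqrt -
        ∑ t ∈ Finset.range c, (-1 : ℂ) ^ t.sqrt := by
    rw [Finset.sum_range_add _ c, add_sub_cancel_left]
    refine Finset.sum_congr rfl fun t _ => ?_
    rw [sqrtSignSeq, sum_update]
  have hc' : (c : ℝ) ≤ d * n i := by exact_mod_cast hc
  have hn : (0 : ℝ) ≤ n i := Nat.cast_nonneg _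
  have hd' : (0 : ℝ) ≤ d := Nat.cast_nonneg _
  rw [h1]
  refine (norm_sub_le_of_le (norm_sum_range_neg_one_pow_sqrt_le _)
    (norm_sum_range_neg_one_pow_sqrt_le _)).trans ?_
  have h2 := nat_sqrt_cast_le (x := c + (n i + 1)) (n := n i) (C := d + 1)
    (by push_cast; nlinarith)
  have h3 := nat_sqrt_cast_le (x := c) (n := n i) (C := d + 1) (by nlinarith)
  linarith

theorem hasMean_sqrtSignSeq_mul (hd : 0 < d) (z : Torus d) :
    HasMean (fun k => sqrtSignSeq d k * conj (natMonomial z k)) 0 := by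
  by_cases hz : z = 1
  · simpa [hz, natMonomial_one] using hasMean_sqrtSignSeq hd
  · exact hasMean_sqrtSignSeq_mul_of_ne hz

/-- The oscillation of `⌊√·⌋` in a window of fixed radius is negligible on average: along a line it
sums to `O(√(n i))`. -/
theorem realAverage_sqrt_increment_le (R : ℕ) (n : Fin d → ℕ) (i : Fin d) :
    realAverage (fun k => ((∑ j, k j + R).sqrt : ℝ) - ((∑ j, k j - R).sqrt : ℝ)) n ≤
      2 * R * (√(2 * R + 1) + 1) / √((n i : ℝ) + 1) := by
  rw [← mul_sqrt_div_self]
  refine realAverage_le_of_fiber i fun k _ => ?_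
  set c := ∑ j ∈ Finset.univ \ {i}, k j
  -- Recentring by `R` turns the symmetric window into a forward shift by `2 * R`; truncated
  -- subtraction keeps `g` monotone.
  let g : ℕ → ℝ := fun t => ((c + t - R).sqrt : ℝ)
  have hg : Monotone g := fun s t hst => by
    simp only [g]
    exact_mod_cast Nat.sqrt_le_sqrt (by omega)
  have h1 : ∑ t ∈ Finset.range (n i + 1), (((∑ j, Function.update k i t j + R).sqrt : ℝ) -
      ((∑ j, Function.update k i t j - R).sqrt : ℝ)) =
      ∑ t ∈ Finset.range (n i + 1), (g (t + 2 * R) - g t) := by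
    refine Finset.sum_congr rfl fun t _ => ?_
    simp only [g, sum_update]
    congr 4
    omega
  rw [h1]
  refine (sum_range_shift_sub_le hg _ _).trans ?_
  have h2 : g (n i + 1 + 2 * R) - g 0 ≤ (n i + 1 + 2 * R).sqrt + 1 := by
    have h3 : (c + (n i + 1 + 2 * R) - R).sqrt ≤ (c + 0 - R).sqrt + (n i + 1 + 2 * R).sqrt + 1 :=
      (Nat.sqrt_le_sqrt (by omega)).trans (nat_sqrt_add_le _ _)
    have h4 : ((c + (n i + 1 + 2 * R) - R).sqrt : ℝ) ≤
      (c + 0 - R).sqrt + (n i + 1 + 2 * R).sqrt + 1 := by exact_mod_cast h3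
    simp only [g]
    linarith
  have h5 := nat_sqrt_cast_le (x := n i + 1 + 2 * R) (n := n i) (C := 2 * R + 1) (by
    have : (0 : ℝ) ≤ n i := Nat.cast_nonneg _
    have : (0 : ℝ) ≤ R := Nat.cast_nonneg _
    push_cast
    nlinarith)
  have h6 := one_le_sqrt_cast_add_one (n i)
  calc ((2 * R : ℕ) : ℝ) * (g (n i + 1 + 2 * R) - g 0)
      ≤ ((2 * R : ℕ) : ℝ) * ((√(2 * R + 1) + 1) * √((n i : ℝ) + 1)) := by
        gcongr
        linarith
    _ = _ := by push_cast; ring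

/-- A product of two signs differs from one exactly as the signs differ from each other, and the
shift moves the coordinate sum by `∑ j, m j`. -/
theorem norm_sqrtSignSeq_mul_shift_sub_one_le {m : Fin d → ℤ} {k : Fin d → ℕ}
    (h : ∀ i, 0 ≤ (k i : ℤ) + m i) :
    ‖conj (sqrtSignSeq d k) * zeroExtend (sqrtSignSeq d) (toInt k + m) - 1‖ ≤
      2 * (((∑ j, k j + (∑ j, m j).natAbs).sqrt : ℝ) -
        ((∑ j, k j - (∑ j, m j).natAbs).sqrt : ℝ)) := by
  obtain ⟨l, hl⟩ := exists_toInt_eq (k := toInt k + m) h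
  have hsum : ((∑ j, l j : ℕ) : ℤ) = (∑ j, k j : ℕ) + ∑ j, m j := by
    push_cast
    rw [← Finset.sum_add_distrib]
    exact Finset.sum_congr rfl fun j _ => congrFun hl j
  rw [← hl, zeroExtend_toInt]
  simp only [sqrtSignSeq, map_pow, map_neg, map_one]
  generalize ∑ j, l j = t at *
  generalize ∑ j, k j = s at *
  set R := (∑ j, m j).natAbs
  have h1 : ‖((-1) ^ s.sqrt * (-1) ^ t.sqrt - 1 : ℂ)‖ = ‖((-1) ^ t.sqrt - (-1) ^ s.sqrt : ℂ)‖ := by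
    have h2 : ((-1) ^ s.sqrt * (-1) ^ s.sqrt : ℂ) = 1 := by rw [← mul_pow]; simp
    calc _ = ‖((-1) ^ s.sqrt * ((-1) ^ t.sqrt - (-1) ^ s.sqrt) : ℂ)‖ := by rw [mul_sub, h2]
      _ = _ := by rw [norm_mul, norm_pow, norm_neg, norm_one, one_pow, one_mul]
  have hsR : ((s - R : ℕ).sqrt : ℝ) ≤ s.sqrt := by exact_mod_cast Nat.sqrt_le_sqrt (by omega)
  have hsR' : (s.sqrt : ℝ) ≤ (s + R).sqrt := by exact_mod_cast Nat.sqrt_le_sqrt (by omega)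
  rw [h1]
  rcases le_total s t with hst | hst
  · have : (t.sqrt : ℝ) ≤ (s + R).sqrt := by exact_mod_cast Nat.sqrt_le_sqrt (by omega)
    linarith [norm_neg_one_pow_sub_le (Nat.sqrt_le_sqrt hst)]
  · have : ((s - R : ℕ).sqrt : ℝ) ≤ t.sqrt := by exact_mod_cast Nat.sqrt_le_sqrt (by omega)
    rw [norm_sub_rev]
    linarith [norm_neg_one_pow_sub_le (Nat.sqrt_le_sqrt hst)]

theorem isCorrelation_sqrtSignSeq (hd : 0 < d) : IsCorrelation (sqrtSignSeq d) fun _ => 1 := by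
  classical
  intro m
  rw [correlationAverage_eq]
  set R := (∑ j, m j).natAbs
  have h0 : Tendsto (fun n => 2 * leaving m n +
      2 * (2 * R * (√(2 * R + 1) + 1) / √((n ⟨0, hd⟩ : ℝ) + 1))) atTop (𝓝 0) := by
    simpa using ((tendsto_leaving m).const_mul 2).add
      ((tendsto_const_div_sqrt_atTop (2 * R * (√(2 * R + 1) + 1)) ⟨0, hd⟩).const_mul 2)
  refine tendsto_iff_norm_sub_tendsto_zero.2 (squeeze_zero (fun _ => norm_nonneg _) (fun n => ?_) h0)
  have h1 : (1 : ℂ) = average (fun _ => 1) n := by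
    have := average_ofReal (fun _ => 1) n
    rw [realAverage_const] at this
    simpa using this.symm
  change ‖_ - (1 : ℂ)‖ ≤ _
  rw [h1, ← average_sub]
  -- Points leaving the box have vanishing proportion and cost at most two each; at the others the
  -- sign can change only as `⌊√·⌋` moves.
  calc _ ≤ realAverage (fun k => 2 * (if ShiftsInto m n k then 0 else 1) +
        2 * (((∑ j, k j + R).sqrt : ℝ) - ((∑ j, k j - R).sqrt : ℝ))) n := by
        refine (norm_average_le _ n).trans (realAverage_mono fun k _ => ?_)
        split_ifs with h
        · rw [mul_zero, zero_add]
          exact norm_sqrtSignSeq_mul_shift_sub_one_le fun i => (h i).1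
        · have h2 : ((∑ j, k j - R).sqrt : ℝ) ≤ (∑ j, k j + R).sqrt := by
            exact_mod_cast Nat.sqrt_le_sqrt (by omega)
          have h3 : ‖conj (sqrtSignSeq d k) * zeroExtend (sqrtSignSeq d) (toInt k + m)‖ ≤ 1 := by
            rw [norm_mul, RCLike.norm_conj, norm_sqrtSignSeq, one_mul]
            exact norm_zeroExtend_le (fun k => (norm_sqrtSignSeq k).le) _
          refine (norm_sub_le_of_le h3 norm_one.le).trans ?_
          linarith
    _ ≤ _ := by
        rw [realAverage_add, realAverage_const_mul, realAverage_const_mul]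
        gcongr
        · exact le_rfl
        · exact realAverage_sqrt_increment_le R n ⟨0, hd⟩

theorem spectralMeasure_sqrtSignSeq (hd : 0 < d) :
    spectralMeasure (sqrtSignSeq d) = Measure.dirac 1 := by
  have hcor := isCorrelation_sqrtSignSeq hd
  have hσ := isSpectralMeasure_spectralMeasure ⟨_, hcor⟩ (isBoundedSeq_sqrtSignSeq (d := d))
  have := hσ.1
  refine ext_of_integral_intMonomial fun m => ?_
  rw [integral_dirac, intMonomial_one]
  exact tendsto_nhds_unique (hσ.2 m) (hcor m)

/-- `classD` omits the conjugate, so its limit at `z` is the amplitude at `z⁻¹`. -/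
theorem HasAmplitude.hasMean_mul_natMonomial {a : MultiSeq d} (h : HasAmplitude a) (z : Torus d) :
    ∃ L, Tendsto (average fun k => a k * natMonomial z k) atTop (𝓝 L) := by
  obtain ⟨L, hL⟩ := h z⁻¹
  refine ⟨L, ?_⟩
  simpa only [amplitudeAverage, natMonomial_inv, Complex.conj_conj] using hL

end MultiSeq

theorem mainTheorem6 (d : ℕ) (hd : 0 < d) :
    (∀ a : MultiSeq d, MultiSeq.IsBoundedBesicovitch a ↔
      (MultiSeq.BoundedDiscreteSpectrum a ∧ MultiSeq.HasAmplitude a ∧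
        MultiSeq.AtomsEqAmplitudeSq a)) ∧
    (MultiSeq.BoundedDiscreteSpectrum (MultiSeq.sqrtSignSeq d) ∧
      MultiSeq.HasAmplitude (MultiSeq.sqrtSignSeq d) ∧
      ¬ MultiSeq.AtomsEqAmplitudeSq (MultiSeq.sqrtSignSeq d) ∧
      MultiSeq.IsCorrelation (MultiSeq.sqrtSignSeq d) (fun _ => 1) ∧
      MultiSeq.spectralMeasure (MultiSeq.sqrtSignSeq d) = MeasureTheory.Measure.dirac 1 ∧
      ∀ z : Torus d, MultiSeq.amplitude (MultiSeq.sqrtSignSeq d) z = 0) ∧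
    {a : MultiSeq d | MultiSeq.IsBoundedBesicovitch a} ⊂ MultiSeq.classD d := by
  have hcor := MultiSeq.isCorrelation_sqrtSignSeq hd
  have hσ := MultiSeq.spectralMeasure_sqrtSignSeq hd
  have hΓ : ∀ z : Torus d, MultiSeq.amplitude (MultiSeq.sqrtSignSeq d) z = 0 := fun z =>
    (MultiSeq.hasMean_sqrtSignSeq_mul hd z).amplitude_eq
  have hspec : MultiSeq.BoundedDiscreteSpectrum (MultiSeq.sqrtSignSeq d) := by
    refine ⟨⟨_, hcor⟩, MultiSeq.isBoundedSeq_sqrtSignSeq, {1}, Set.countable_singleton 1, ?_⟩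
    rw [hσ]
    simp
  have hamp : MultiSeq.HasAmplitude (MultiSeq.sqrtSignSeq d) := fun z =>
    ⟨0, MultiSeq.hasMean_sqrtSignSeq_mul hd z⟩
  -- At `z = 1` the atom has mass one while the amplitude is zero.
  have hnot : ¬ MultiSeq.AtomsEqAmplitudeSq (MultiSeq.sqrtSignSeq d) := fun h => by
    have := h 1
    rw [hσ, hΓ] at this
    simp [measureReal_def] at this
  refine ⟨MultiSeq.isBoundedBesicovitch_iff, ⟨hspec, hamp, hnot, hcor, hσ, hΓ⟩, ?_⟩
  refine (Set.ssubset_iff_of_subset fun a ha => ?_).2 ⟨MultiSeq.sqrtSignSeq d, ?_, fun h => ?_⟩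
  · obtain ⟨⟨h1, h2, h3⟩, h4, -⟩ := (MultiSeq.isBoundedBesicovitch_iff a).1 ha
    exact ⟨h1, h2, h3, h4.hasMean_mul_natMonomial⟩
  · exact ⟨hspec.1, hspec.2.1, hspec.2.2, hamp.hasMean_mul_natMonomial⟩
  · exact hnot ((MultiSeq.isBoundedBesicovitch_iff _).1 h).2.2
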